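/- Let $d\in\mathbb N$ and $\mathbb T^d=(\mathbb R/2\pi\mathbb Z)^d$ with Lebesgue measure. For $k\in\mathbb Z^d$ put $\varphi_k(x)=(2\pi)^{-d/2}e^{ik\cdot x}$ and $\lambda_k=|k|^2$, and for real-valued $f\in L^2(\mathbb T^d)$ let $\langle f,\varphi_k\rangle=\int_{\mathbb T^d}f\,\overline{\varphi_k}\,dx$. Let $H^1(\mathbb T^d)$ be the space of real-valued $f\in L^2(\mathbb T^d)$ with $\sum_k\lambda_k|\langle f,\varphi_k\rangle|^2<\infty$, with norm $\|f\|_{H^1}^2=\|f\|_{L^2}^2+\sum_k\lambda_k|\langle f,\varphi_k\rangle|^2$, and put $\|(w,v)\|_{H^1\times L^2}^2=\|w\|_{H^1}^2+\|v\|_{L^2}^2$. Consider the bilinear wave equation $$\partial_t^2 w(x,t)=\Big(\Delta+\sum_{j=0}^{2d}p_j(t)\mu_j(x)\Big)w(x,t),\qquad(\mu_0,\dots,\mu_{2d})=(1,\cos x_1,\sin x_1,\dots,\cos x_d,\sin x_d).\tag{1}$$ For a control $p:[0,\tau]\to\mathbb R^{2d+1}$ and $W_0\in H^1\times L^2(\mathbb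 T^d)$, the solution of (1) with initial condition $(w,\partial_tw)(0)=W_0$ is the function $W=(w,\partial_t w)\in C^0([0,\tau],H^1\times L^2(\mathbb T^d))$ such that $$W(t)=e^{t\mathcal A}W_0+\int_0^te^{(t-s)\mathcal A}\Big(\sum_{j=0}^{2d}p_j(s)\mu_j\mathcal B\Big)W(s)\,ds,\qquad t\in[0,\tau],$$ where $\mathcal B(w,v)=(0,w)$ and $e^{t\mathcal A}$ is the free wave evolution: $e^{t\mathcal A}(w_0,v_0)=(w(t),v(t))$ with $$w(t)=\sum_{k}\Big(\langle w_0,\varphi_k\rangle\cos(\sqrt{\lambda_k}t)+\langle v_0,\varphi_k\rangle\tfrac{\sin(\sqrt{\lambda_k}t)}{\sqrt{\lambda_k}}\Big)\varphi_k,\qquad v(t)=\sum_{k}\Big(-\sqrt{\lambda_k}\langle w_0,\varphi_k\rangle\sin(\sqrt{\lambda_k}t)+\langle v_0,\varphi_k\rangle\cos(\sqrt{\lambda_k}t)\Big)\varphi_k,$$ the quotient being read as $t$ for $k=0$. Theorem. Let $(w_0,\dot w_0)\in H^1\times L^2(\mathbb T^d)$ be such that either (a) $w_0\neq0$ and $\langle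 w_0,e^{ik\cdot x}\rangle_{L^2}=0$ for all but finitely many $k\in\mathbb Z^d$, or (b) $w_0=0$, $\dot w_0\neq0$ and $\langle\dot w_0,e^{ik\cdot x}\rangle_{L^2}=0$ for all but finitely many $k\in\mathbb Z^d$. Then for every $(w_1,\dot w_1)\in H^1\times L^2(\mathbb T^d)$ and all $\varepsilon,T>0$ there exist a time $\tau\in[0,T)$ and a piecewise constant control $p:[0,\tau]\to\mathbb R^{2d+1}$ such that the solution $w$ of (1) with initial condition $(w,\partial_tw)(0)=(w_0,\dot w_0)$ satisfies $$\big\|(w(\cdot,\tau),\partial_tw(\cdot,\tau))-(w_1,\dot w_1)\big\|_{H^1\times L^2(\mathbb T^d)}<\varepsilon.$$ -/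

import Mathlib

open MeasureTheory Set
open scoped ENNReal ComplexConjugate

noncomputable section

namespace BilinearWave

instance two_pi_pos : Fact (0 < 2 * Real.pi) := ⟨Real.two_pi_pos⟩

/-- The torus `𝕋ᵈ = (ℝ / 2πℤ)ᵈ`; its `volume` is the Lebesgue measure, of total mass `(2π)ᵈ`. -/
abbrev Torus (d : ℕ) : Type := Fin d → AddCircle (2 * Real.pi)

/-- `L²(𝕋ᵈ, ℝ)`. -/
abbrev L2 (d : ℕ) : Type := Lp ℝ 2 (volume : Measure (Torus d))

/-- The eigenfunction `φ_k(x) = (2π)^{-d/2} e^{i k·x}` of `-Δ`. -/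
def phi {d : ℕ} (k : Fin d → ℤ) : C(Torus d, ℂ) where
  toFun x := (((2 * Real.pi) ^ (-(d : ℝ) / 2) : ℝ) : ℂ) * ∏ i, fourier (k i) (x i)

/-- `|k| = √λ_k`, where `λ_k = |k|² = ∑ k_i²` is the eigenvalue of `-Δ` at `φ_k`. -/
def freq {d : ℕ} (k : Fin d → ℤ) : ℝ := Real.sqrt (∑ i, (k i : ℝ) ^ 2)

/-- The Fourier coefficient `⟨f, φ_k⟩ = ∫ f(x) \overline{φ_k(x)} dx`. -/
def coef {d : ℕ} (f : L2 d) (k : Fin d → ℤ) : ℂ := ∫ x, (f x : ℂ) * conj (phi k x)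

/-- The real function `x ↦ Re (c φ_k(x))`. -/
def modeFun {d : ℕ} (k : Fin d → ℤ) (c : ℂ) : C(Torus d, ℝ) where
  toFun x := (c * phi k x).re

/-- `Re (c φ_k)` as an element of `L²(𝕋ᵈ, ℝ)`. If `f` is real valued then
`f = ∑ ⟨f, φ_k⟩ φ_k = ∑ Re (⟨f, φ_k⟩ φ_k)`. -/
def mode {d : ℕ} (k : Fin d → ℤ) (c : ℂ) : L2 d :=
  ContinuousMap.toLp 2 volume ℝ (modeFun k c)

/-! ### Elementary facts on Fourier coefficients -/

theorem coef_eq_inner {d : ℕ} (f : L2 d) (k : Fin d → ℤ) :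
    coef f k = ((inner ℝ (mode k 1) f : ℝ) : ℂ)
      + ((inner ℝ (mode k Complex.I) f : ℝ) : ℂ) * Complex.I := by
  have key : ∀ c : ℂ, inner ℝ (mode k c) f = ∫ x, f x * (c * phi k x).re := by
    intro c
    rw [L2.inner_def]
    refine integral_congr_ae ?_
    filter_upwards [ContinuousMap.coeFn_toLp (p := 2) (𝕜 := ℝ) volume (modeFun k c)] with x hx
    rw [mode, hx]
    rfl
  have hint : ∀ c : ℂ, Integrable (fun x => f x * (c * phi k x).re) := by
    intro c
    have := L2.integrable_inner (𝕜 := ℝ) (mode k c) f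
    refine this.congr ?_
    filter_upwards [ContinuousMap.coeFn_toLp (p := 2) (𝕜 := ℝ) volume (modeFun k c)] with x hx
    rw [mode, hx]
    rfl
  rw [key, key, ← integral_complex_ofReal, ← integral_complex_ofReal, ← integral_mul_const,
    ← integral_add (hint 1).ofReal ((hint Complex.I).ofReal.mul_const _)]
  refine integral_congr_ae (Filter.Eventually.of_forall fun x => ?_)
  apply Complex.ext <;> simp

theorem continuous_coef {d : ℕ} (k : Fin d → ℤ) : Continuous fun f : L2 d => coef f k := by
  simp only [coef_eq_inner]
  fun_prop

theorem coef_add {d : ℕ} (f g : L2 d) (k : Fin d → ℤ) :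
    coef (f + g) k = coef f k + coef g k := by
  simp only [coef_eq_inner, inner_add_right, Complex.ofReal_add]
  ring

theorem coef_smul {d : ℕ} (a : ℝ) (f : L2 d) (k : Fin d → ℤ) :
    coef (a • f) k = (a : ℂ) * coef f k := by
  simp only [coef_eq_inner, inner_smul_right, Complex.ofReal_mul]
  ring

theorem coef_zero {d : ℕ} (k : Fin d → ℤ) : coef (0 : L2 d) k = 0 := by
  simp [coef_eq_inner]

theorem integral_phi {d : ℕ} {k : Fin d → ℤ} (hk : k ≠ 0) : ∫ x, phi k x = 0 := by
  obtain ⟨i, hi⟩ := Function.ne_iff.1 hk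
  have h1 : ∫ t : AddCircle (2 * Real.pi), fourier (k i) t = 0 := by
    have h := (orthonormal_iff_ite.1 (orthonormal_fourier (T := 2 * Real.pi))) 0 (k i)
    rw [if_neg (fun h => hi h.symm), fourierLp, fourierLp, ContinuousMap.inner_toLp] at h
    rw [AddCircle.volume_eq_smul_haarAddCircle, integral_smul_measure]
    simp only [fourier_zero, map_one, mul_one] at h
    rw [h, smul_zero]
  have h2 : ∫ x : Torus d, ∏ i, fourier (k i) (x i) = 0 := by
    rw [integral_fintype_prod_volume_eq_prod (fun i (t : AddCircle (2 * Real.pi)) => fourier (k i) t)]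
    exact Finset.prod_eq_zero (Finset.mem_univ i) h1
  simp only [phi, ContinuousMap.coe_mk, integral_const_mul, h2, mul_zero]

theorem coef_mode_eq_zero {d : ℕ} (k j : Fin d → ℤ) (c : ℂ) (h1 : j ≠ k) (h2 : j ≠ -k) :
    coef (mode k c) j = 0 := by
  set A : ℝ := (2 * Real.pi) ^ (-(d : ℝ) / 2) with hA
  have e1 : ∀ x : Torus d, ((modeFun k c x : ℝ) : ℂ) * conj (phi j x)
      = c / 2 * A * phi (k - j) x + conj c / 2 * A * phi (-k - j) x := by
    intro x
    have hre : ((modeFun k c x : ℝ) : ℂ) = (c * phi k x + conj (c * phi k x)) / 2 := by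
      exact Complex.re_eq_add_conj _
    rw [hre]
    simp only [phi, ContinuousMap.coe_mk, map_mul, map_prod, Complex.conj_ofReal, ← fourier_neg,
      ← hA, Pi.sub_apply, Pi.neg_apply, sub_eq_add_neg, fourier_add, Finset.prod_mul_distrib]
    ring
  have hint : ∀ m : Fin d → ℤ, Integrable (fun x => phi m x) := fun m =>
    (phi m).continuous.integrable_of_hasCompactSupport (HasCompactSupport.of_compactSpace _)
  calc coef (mode k c) j
      = ∫ x, ((modeFun k c x : ℝ) : ℂ) * conj (phi j x) := by
        refine integral_congr_ae ?_
        filter_upwards [ContinuousMap.coeFn_toLp (p := 2) (𝕜 := ℝ) volume (modeFun k c)] with x hx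
        rw [mode, hx]
    _ = ∫ x, (c / 2 * A * phi (k - j) x + conj c / 2 * A * phi (-k - j) x) := by
        simp only [e1]
    _ = 0 := by
        rw [integral_add ((hint _).const_mul _) ((hint _).const_mul _), integral_const_mul,
          integral_const_mul, integral_phi (sub_ne_zero.2 h1.symm),
          integral_phi (sub_ne_zero.2 h2.symm)]
        simp

/-! ### The Sobolev space `H¹(𝕋ᵈ, ℝ)` -/

/-- The weighted coefficients `|k| ⟨f, φ_k⟩`. -/
def wcoef {d : ℕ} (f : L2 d) (k : Fin d → ℤ) : ℂ := (freq k : ℂ) * coef f k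

/-- The functions `f ∈ L²(𝕋ᵈ, ℝ)` with `∑ λ_k |⟨f, φ_k⟩|² < ∞`. -/
def H1Submodule (d : ℕ) : Submodule ℝ (L2 d) where
  carrier := {f | Summable fun k : Fin d → ℤ => freq k ^ 2 * ‖coef f k‖ ^ 2}
  zero_mem' := by simp [coef_zero]
  add_mem' := by
    intro f g hf hg
    refine Summable.of_nonneg_of_le (fun k => by positivity) (fun k => ?_)
      ((hf.mul_left 2).add (hg.mul_left 2))
    rw [coef_add]
    have h := norm_add_le (coef f k) (coef g k)
    have h' : ‖coef f k + coef g k‖ ^ 2 ≤ 2 * ‖coef f k‖ ^ 2 + 2 * ‖coef g k‖ ^ 2 := by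
      nlinarith [norm_nonneg (coef f k + coef g k), sq_nonneg (‖coef f k‖ - ‖coef g k‖)]
    nlinarith [mul_le_mul_of_nonneg_left h' (sq_nonneg (freq k))]
  smul_mem' := by
    intro a f hf
    refine (hf.mul_left (a ^ 2)).congr fun k => ?_
    rw [coef_smul, norm_mul, mul_pow, Complex.norm_real, Real.norm_eq_abs, sq_abs]
    ring

/-- `H¹(𝕋ᵈ, ℝ)`; its norm, defined below, is not the one of `L²`. -/
def H1 (d : ℕ) : Type := ↥(H1Submodule d)

namespace H1

instance (d : ℕ) : AddCommGroup (H1 d) := inferInstanceAs (AddCommGroup ↥(H1Submodule d))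

instance (d : ℕ) : Module ℝ (H1 d) := inferInstanceAs (Module ℝ ↥(H1Submodule d))

/-- The inclusion `H¹ ⊆ L²`. -/
def toL2 {d : ℕ} : H1 d →ₗ[ℝ] L2 d := (H1Submodule d).subtype

theorem memlp_wcoef {d : ℕ} (u : H1 d) : Memℓp (wcoef (toL2 u)) 2 := by
  refine memℓp_gen ?_
  refine (show Summable _ from u.2).congr fun k => ?_
  simp [wcoef, mul_pow, sq_abs]
  exact Or.inl rfl

/-- The map `u ↦ (u, (|k| ⟨u, φ_k⟩)_k)` into the Hilbert space `L² × ℓ²(ℤᵈ)`. -/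
def embed (d : ℕ) :
    H1 d →ₗ[ℝ] WithLp 2 (L2 d × lp (fun _ : Fin d → ℤ => ℂ) 2) where
  toFun u := WithLp.toLp 2 (toL2 u, ⟨wcoef (toL2 u), memlp_wcoef u⟩)
  map_add' u v := by
    apply (WithLp.ofLp_injective 2)
    refine Prod.ext (by simp) (lp.ext (funext fun k => ?_))
    change wcoef (toL2 (u + v)) k = wcoef (toL2 u) k + wcoef (toL2 v) k
    simp [wcoef, coef_add, mul_add]
  map_smul' a u := by
    apply (WithLp.ofLp_injective 2)
    refine Prod.ext (by simp) (lp.ext (funext fun k => ?_))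
    simp [wcoef, coef_smul]
    ring

theorem embed_injective (d : ℕ) : Function.Injective (embed d) := by
  intro u v h
  exact Subtype.ext (congrArg (fun z => (WithLp.ofLp z).1) h)

/-- The norm `‖u‖_{H¹}² = ‖u‖_{L²}² + ∑ λ_k |⟨u, φ_k⟩|²`. -/
instance (d : ℕ) : NormedAddCommGroup (H1 d) :=
  NormedAddCommGroup.induced (H1 d) _ (embed d) (embed_injective d)

instance (d : ℕ) : NormedSpace ℝ (H1 d) := NormedSpace.induced ℝ (H1 d) _ (embed d)

theorem norm_sq_eq {d : ℕ} (u : H1 d) :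
    ‖u‖ ^ 2 = ‖toL2 u‖ ^ 2 + ∑' k : Fin d → ℤ, freq k ^ 2 * ‖coef (toL2 u) k‖ ^ 2 := by
  have h : ‖u‖ = ‖embed d u‖ := rfl
  rw [h, WithLp.prod_norm_sq_eq_of_L2]
  congr 1
  have h2 := lp.norm_rpow_eq_tsum (p := 2) (by norm_num)
    (⟨wcoef (toL2 u), memlp_wcoef u⟩ : lp (fun _ : Fin d → ℤ => ℂ) 2)
  simp only [ENNReal.toReal_ofNat, Real.rpow_ofNat] at h2
  refine h2.trans (tsum_congr fun k => ?_)
  simp [wcoef, mul_pow, sq_abs]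

instance (d : ℕ) : CompleteSpace (H1 d) := by
  have hiso : Isometry (embed d) := AddMonoidHomClass.isometry_of_norm (embed d) fun _ => rfl
  have hrange : Set.range (embed d) = {z : WithLp 2 (L2 d × lp (fun _ : Fin d → ℤ => ℂ) 2) |
      ∀ k, (WithLp.ofLp z).2 k = wcoef (WithLp.ofLp z).1 k} := by
    ext z
    constructor
    · rintro ⟨u, rfl⟩ k
      rfl
    · intro hz
      have hmem : (WithLp.ofLp z).1 ∈ H1Submodule d := by
        have := (lp.memℓp (WithLp.ofLp z).2).summable (by norm_num)
        refine this.congr fun k => ?_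
        rw [hz k]
        simp [wcoef, mul_pow, sq_abs]
      refine ⟨⟨(WithLp.ofLp z).1, hmem⟩, WithLp.ofLp_injective 2 ?_⟩
      exact Prod.ext rfl (lp.ext (funext fun k => (hz k).symm))
  have hclosed : IsClosed (Set.range (embed d)) := by
    rw [hrange, Set.ofPred_forall]
    refine isClosed_iInter fun k => isClosed_eq ?_ ?_
    · have h1 : Continuous fun a : lp (fun _ : Fin d → ℤ => ℂ) 2 => a k :=
        (continuous_apply k).comp (lp.uniformContinuous_coe (p := 2)).continuous
      exact h1.comp (continuous_snd.comp (WithLp.prod_continuous_ofLp 2 _ _))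
    · exact continuous_const.mul
        ((continuous_coef k).comp (continuous_fst.comp (WithLp.prod_continuous_ofLp 2 _ _)))
  exact (completeSpace_iff_isComplete_range hiso.isUniformInducing).2 hclosed.isComplete

/-- `Re (c φ_k)` as an element of `H¹(𝕋ᵈ, ℝ)`. -/
def mode {d : ℕ} (k : Fin d → ℤ) (c : ℂ) : H1 d :=
  ⟨BilinearWave.mode k c, by
    refine summable_of_ne_finset_zero (s := {k, -k}) fun j hj => ?_
    simp only [Finset.mem_insert, Finset.mem_singleton, not_or] at hj
    rw [coef_mode_eq_zero k j c hj.1 hj.2]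
    simp⟩

end H1

/-! ### The control system -/

/-- The state space `H¹ × L²(𝕋ᵈ, ℝ)` of pairs (profile, velocity). -/
abbrev State (d : ℕ) : Type := H1 d × L2 d

/-- The norm `(‖w‖_{H¹}² + ‖v‖_{L²}²)^{1/2}` of `H¹ × L²`. It is equivalent to the norm that Mathlib
puts on the product, which is used only for continuity and integrals. -/
def energyNorm {d : ℕ} (W : State d) : ℝ := Real.sqrt (‖W.1‖ ^ 2 + ‖W.2‖ ^ 2)

/-- `sin(√λ_k t) / √λ_k`, read as `t` for `k = 0`. -/
def sinDiv {d : ℕ} (k : Fin d → ℤ) (t : ℝ) : ℝ :=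
  if k = 0 then t else Real.sin (freq k * t) / freq k

/-- The free evolution `e^{t𝒜}(w₀, v₀)`, given by its Fourier series, converging in `H¹ × L²`:
`w(t) = ∑ (⟨w₀, φ_k⟩ cos(√λ_k t) + ⟨v₀, φ_k⟩ sin(√λ_k t)/√λ_k) φ_k`,
`∂ₜw(t) = ∑ (-√λ_k ⟨w₀, φ_k⟩ sin(√λ_k t) + ⟨v₀, φ_k⟩ cos(√λ_k t)) φ_k`. -/
def freeEvolution {d : ℕ} (t : ℝ) (W : State d) : State d :=
  (∑' k : Fin d → ℤ, H1.mode k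
      (coef W.1.toL2 k * (Real.cos (freq k * t) : ℝ) + coef W.2 k * (sinDiv k t : ℝ)),
   ∑' k : Fin d → ℤ, mode k
      (-(freq k : ℂ) * coef W.1.toL2 k * (Real.sin (freq k * t) : ℝ)
        + coef W.2 k * (Real.cos (freq k * t) : ℝ)))

/-- The function `x ↦ cos x_i` on the torus. -/
def cosFun {d : ℕ} (i : Fin d) : C(Torus d, ℝ) where
  toFun x := Real.Angle.cos (x i)
  continuous_toFun := Real.Angle.continuous_cos.comp (continuous_apply i)

/-- The function `x ↦ sin x_i` on the torus. -/
def sinFun {d : ℕ} (i : Fin d) : C(Torus d, ℝ) where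
  toFun x := Real.Angle.sin (x i)
  continuous_toFun := Real.Angle.continuous_sin.comp (continuous_apply i)

/-- `(μ_0, …, μ_{2d}) = (1, cos x_1, sin x_1, …, cos x_d, sin x_d)`. -/
def mu {d : ℕ} (j : Fin (2 * d + 1)) : C(Torus d, ℝ) :=
  if hj : j = 0 then 1
  else
    have hlt : ((j : ℕ) - 1) / 2 < d := by
      have h0 : (j : ℕ) ≠ 0 := fun h => hj (Fin.ext h)
      have := j.isLt
      omega
    if Odd (j : ℕ) then cosFun ⟨((j : ℕ) - 1) / 2, hlt⟩
    else sinFun ⟨((j : ℕ) - 1) / 2, hlt⟩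

/-- The product of a continuous function with an element of `L²`. -/
def mulL2 {d : ℕ} (m : C(Torus d, ℝ)) (f : L2 d) : L2 d :=
  (ContinuousMap.toLp ∞ volume ℝ m : Lp ℝ ∞ (volume : Measure (Torus d))) • f

/-- The operator `(∑_j q_j μ_j) ℬ : (w, v) ↦ (0, (∑_j q_j μ_j) w)`. -/
def controlOp {d : ℕ} (q : Fin (2 * d + 1) → ℝ) (W : State d) : State d :=
  (0, mulL2 (∑ j, q j • mu j) W.1.toL2)

/-- `W` is the (mild) solution on `[0, τ]` of
`∂ₜ²w = (Δ + ∑_j p_j(t) μ_j) w`, `(w, ∂ₜw)(0) = W₀`, with `W = (w, ∂ₜw)`: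
it is continuous with values in `H¹ × L²` and satisfies
`W(t) = e^{t𝒜} W₀ + ∫₀ᵗ e^{(t-s)𝒜} (∑_j p_j(s) μ_j) ℬ W(s) ds`. -/
structure IsSolution {d : ℕ} (τ : ℝ) (p : ℝ → Fin (2 * d + 1) → ℝ) (W₀ : State d)
    (W : ℝ → State d) : Prop where
  continuousOn : ContinuousOn W (Icc 0 τ)
  duhamel : ∀ t ∈ Icc 0 τ,
    IntervalIntegrable (fun s => freeEvolution (t - s) (controlOp (p s) (W s))) volume 0 t ∧
    W t = freeEvolution t W₀ + ∫ s in (0 : ℝ)..t, freeEvolution (t - s) (controlOp (p s) (W s))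

/-- `p : [0, τ] → E` is piecewise constant: there are times `0 = t_0 ≤ t_1 ≤ … ≤ t_n = τ` such that
`p` is constant on every open interval `(t_i, t_{i+1})`. -/
def IsPiecewiseConstant {E : Type*} (τ : ℝ) (p : ℝ → E) : Prop :=
  ∃ (n : ℕ) (t : ℕ → ℝ), Monotone t ∧ t 0 = 0 ∧ t n = τ ∧
    ∀ i < n, ∃ c : E, ∀ s ∈ Ioo (t i) (t (i + 1)), p s = c

/-- `⟨f, e^{ik·x}⟩ = 0` for all but finitely many `k ∈ ℤᵈ`. -/
def FinitelyManyModes {d : ℕ} (f : L2 d) : Prop := {k : Fin d → ℤ | coef f k ≠ 0}.Finite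

end BilinearWave

end

open BilinearWave

/-!
Constant controls `δ⁻¹ q` on a time interval of length `δ → 0` realize the kicks `(w, v) ↦ (w, v +
f w)` with `f` in the span of the `μ_j`. Conjugating the free evolution over time `s²` by the kicks
`± s⁻¹ φ` produces the kick with `f = -φ²` as `s → 0`; by polarization and trigonometric addition
formulas, the kick of every trigonometric polynomial is realizable in arbitrarily small time. A
nonzero `w₀` with finitely many modes vanishes almost nowhere, so the products `f w₀` are dense in
`L²` and every velocity can be imposed on the profile `w₀`. The velocity `t⁻¹ (w - w₀)`, followed
freely over a short time `t`, carries `w₀` to `w`, whose velocity is then corrected in the same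
way, and finite-mode targets are dense. If `w₀ = 0`, a short free evolution turns the velocity into
a nonzero profile with finitely many modes.
-/

noncomputable section

namespace BilinearWave

open Filter Topology

/-! ### Mild solutions of linear evolution equations -/

section MildSolutions

open intervalIntegral

theorem le_mul_exp_of_le_add_integral {m : ℝ → ℝ} {τ a L : ℝ} (hL : 0 ≤ L)
    (hm : ContinuousOn m (Icc 0 τ))
    (h : ∀ t ∈ Icc 0 τ, m t ≤ a + L * ∫ s in (0 : ℝ)..t, m s) :
    ∀ t ∈ Icc 0 τ, m t ≤ a * Real.exp (L * t) := by
  intro t ht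
  have hint : ∀ t ∈ Icc 0 τ, IntervalIntegrable m volume 0 t := fun t ht =>
    ContinuousOn.intervalIntegrable_of_Icc ht.1 (hm.mono (Icc_subset_Icc_right ht.2))
  have hderiv : ∀ t ∈ Icc 0 τ,
      HasDerivWithinAt (fun t => a + L * ∫ s in (0 : ℝ)..t, m s) (L * m t) (Icc 0 τ) t := by
    intro t ht
    have : Fact (t ∈ Icc 0 τ) := ⟨ht⟩
    exact ((integral_hasDerivWithinAt_right (hint t ht)
      (hm.stronglyMeasurableAtFilter_nhdsWithin measurableSet_Icc t)
      (hm t ht)).const_mul L).const_add a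
  have key := le_gronwallBound_of_liminf_deriv_right_le
    (f := fun t => a + L * ∫ s in (0 : ℝ)..t, m s) (f' := fun t => L * m t) (K := L) (ε := 0)
    (fun t ht => (hderiv t ht).continuousWithinAt)
    (fun t ht r hr => ((hderiv t ⟨ht.1, ht.2.le⟩).mono_of_mem_nhdsWithin
      (Icc_mem_nhdsGE_of_mem ht)).liminf_right_slope_le hr)
    (δ := a) (by simp)
    (fun t ht => by
      simpa using mul_le_mul_of_nonneg_left (h t ⟨ht.1, ht.2.le⟩) hL)
    t ht
  rw [gronwallBound_ε0, sub_zero] at key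
  exact (h t ht).trans key

variable {X : Type*} [NormedAddCommGroup X] [NormedSpace ℝ X]

theorem tendsto_clm_apply {ι : Type*} {l : Filter ι} {F : ι → X →L[ℝ] X} {z : ι → X} {C : ℝ}
    {y w : X} (hC : ∀ᶠ i in l, ‖F i‖ ≤ C) (hF : Tendsto (fun i => F i y) l (𝓝 w))
    (hz : Tendsto z l (𝓝 y)) : Tendsto (fun i => F i (z i)) l (𝓝 w) := by
  have hsmall : Tendsto (fun i => F i (z i - y)) l (𝓝 0) := by
    refine squeeze_zero_norm' (hC.mono fun i hi => (F i).le_of_opNorm_le hi _) ?_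
    simpa using ((hz.sub_const y).norm).const_mul C
  simpa using hsmall.add hF

/-- A strongly continuous one-parameter group of bounded operators. -/
structure IsOperatorGroup (U : ℝ → X →L[ℝ] X) : Prop where
  zero : U 0 = 1
  add : ∀ s t x, U (s + t) x = U s (U t x)
  continuous_apply : ∀ x, Continuous fun t => U t x

/-- Mild solutions on `[0, τ]` of `x' = A x + K(t) x` with `x(0) = x₀`, where `A` is the generator
of the group `U`. Integrability of the Duhamel integrand is part of the notion, since the Bochner
integral of a non-integrable function is `0`. -/
structure IsMild (U K : ℝ → X →L[ℝ] X) (τ : ℝ) (x₀ : X) (x : ℝ → X) : Prop where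
  continuousOn : ContinuousOn x (Icc 0 τ)
  duhamel : ∀ t ∈ Icc 0 τ,
    IntervalIntegrable (fun s => U (t - s) (K s (x s))) volume 0 t ∧
    x t = U t x₀ + ∫ s in (0 : ℝ)..t, U (t - s) (K s (x s))

variable {U : ℝ → X →L[ℝ] X}

namespace IsOperatorGroup

theorem apply_neg_apply (hU : IsOperatorGroup U) (t : ℝ) (x : X) : U t (U (-t) x) = x := by
  simp [← hU.add, hU.zero]

theorem neg_apply_apply (hU : IsOperatorGroup U) (t : ℝ) (x : X) : U (-t) (U t x) = x := by
  simp [← hU.add, hU.zero]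

theorem sub_apply (hU : IsOperatorGroup U) (s t : ℝ) (x : X) : U (t - s) x = U t (U (-s) x) := by
  rw [← hU.add, sub_eq_add_neg]

theorem exists_norm_le [CompleteSpace X] (hU : IsOperatorGroup U) (a b : ℝ) :
    ∃ M, ∀ t ∈ Icc a b, ‖U t‖ ≤ M := by
  obtain ⟨M, hM⟩ := banach_steinhaus (g := fun t : Icc a b => U t) fun x => by
    obtain ⟨C, hC⟩ := isCompact_Icc.exists_bound_of_continuousOn (s := Icc a b)
      (hU.continuous_apply x).continuousOn
    exact ⟨C, fun t => hC t t.2⟩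
  exact ⟨M, fun t ht => hM ⟨t, ht⟩⟩

theorem continuousOn_apply [CompleteSpace X] (hU : IsOperatorGroup U) {S : Set ℝ} {g : ℝ → ℝ}
    {y : ℝ → X} (hg : ContinuousOn g S) (hy : ContinuousOn y S) :
    ContinuousOn (fun t => U (g t) (y t)) S := by
  intro t₀ ht₀
  obtain ⟨M, hM⟩ := hU.exists_norm_le (g t₀ - 1) (g t₀ + 1)
  have hnear : ∀ᶠ t in 𝓝[S] t₀, g t ∈ Icc (g t₀ - 1) (g t₀ + 1) :=
    hg t₀ ht₀ (Icc_mem_nhds (by linarith) (by linarith))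
  exact tendsto_clm_apply (hnear.mono fun t => hM (g t))
    (((hU.continuous_apply _).tendsto _).comp (hg t₀ ht₀)) (hy t₀ ht₀)

theorem intervalIntegrable_comp_iff (hU : IsOperatorGroup U) {f : ℝ → X} {a b c : ℝ} :
    IntervalIntegrable (fun s => U c (f s)) volume a b ↔ IntervalIntegrable f volume a b := by
  simp only [intervalIntegrable_iff, IntegrableOn]
  refine ⟨fun h => ?_, (U c).integrable_comp⟩
  simpa only [hU.neg_apply_apply] using (U (-c)).integrable_comp h

end IsOperatorGroup

namespace IsMild

variable {K K' : ℝ → X →L[ℝ] X} {τ τ₁ τ₂ : ℝ} {x₀ y₀ : X} {x x' y : ℝ → X}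

theorem apply_zero (hU : IsOperatorGroup U) (hτ : 0 ≤ τ) (hx : IsMild U K τ x₀ x) : x 0 = x₀ := by
  simpa [hU.zero] using (hx.duhamel 0 ⟨le_rfl, hτ⟩).2

theorem mono (hx : IsMild U K τ₂ x₀ x) (h : τ₁ ≤ τ₂) : IsMild U K τ₁ x₀ x :=
  ⟨hx.continuousOn.mono (Icc_subset_Icc_right h),
    fun t ht => hx.duhamel t ⟨ht.1, ht.2.trans h⟩⟩

theorem congr (hx : IsMild U K τ x₀ x) (hK : EqOn K K' (Ioo 0 τ)) (hxx' : EqOn x x' (Icc 0 τ)) :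
    IsMild U K' τ x₀ x' := by
  refine ⟨hx.continuousOn.congr hxx'.symm, fun t ht => ?_⟩
  obtain ⟨hint, heq⟩ := hx.duhamel t ht
  have hfun : EqOn (fun s => U (t - s) (K s (x s))) (fun s => U (t - s) (K' s (x' s)))
      (Ioo 0 t) := by
    intro s hs
    have hsτ : s < τ := hs.2.trans_le ht.2
    simp only [hK ⟨hs.1, hsτ⟩, hxx' ⟨hs.1.le, hsτ.le⟩]
  refine ⟨hint.congr_uIoo (by rwa [uIoo_of_le ht.1]), ?_⟩
  rw [← hxx' ht, heq, integral_congr_Ioo_of_le ht.1 hfun]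

end IsMild

/-- The mild equation in the interaction picture `z(t) = U(-t) x(t)`. -/
theorem isMild_iff [CompleteSpace X] (hU : IsOperatorGroup U) {K : ℝ → X →L[ℝ] X} {τ : ℝ} {x₀ : X}
    {x : ℝ → X} :
    IsMild U K τ x₀ x ↔ ContinuousOn x (Icc 0 τ) ∧ ∀ t ∈ Icc 0 τ,
      IntervalIntegrable (fun s => U (-s) (K s (x s))) volume 0 t ∧
      U (-t) (x t) = x₀ + ∫ s in (0 : ℝ)..t, U (-s) (K s (x s)) := by
  have hpoint (t : ℝ) :
      (IntervalIntegrable (fun s => U (t - s) (K s (x s))) volume 0 t ∧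
        x t = U t x₀ + ∫ s in (0 : ℝ)..t, U (t - s) (K s (x s))) ↔
      (IntervalIntegrable (fun s => U (-s) (K s (x s))) volume 0 t ∧
        U (-t) (x t) = x₀ + ∫ s in (0 : ℝ)..t, U (-s) (K s (x s))) := by
    simp only [hU.sub_apply, hU.intervalIntegrable_comp_iff]
    refine and_congr_right fun hint => ?_
    rw [(U t).intervalIntegral_comp_comm hint, ← map_add]
    constructor
    · intro h
      rw [h, hU.neg_apply_apply]
    · intro h
      rw [← h, hU.apply_neg_apply]
  exact ⟨fun h => ⟨h.continuousOn, fun t ht => (hpoint t).1 (h.duhamel t ht)⟩,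
    fun h => ⟨h.1, fun t ht => (hpoint t).2 (h.2 t ht)⟩⟩

namespace IsMild

variable {K K₁ K₂ : ℝ → X →L[ℝ] X} {τ τ₁ τ₂ : ℝ} {x₀ y₀ : X} {x y : ℝ → X}

theorem append [CompleteSpace X] (hU : IsOperatorGroup U) (hτ₁ : 0 ≤ τ₁)
    (hx : IsMild U K τ₁ x₀ x)
    (hy : IsMild U (fun s => K (τ₁ + s)) τ₂ (x τ₁) (fun t => x (τ₁ + t))) :
    IsMild U K (τ₁ + τ₂) x₀ x := by
  rw [isMild_iff hU] at hx hy ⊢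
  have hcont : ContinuousOn x (Icc τ₁ (τ₁ + τ₂)) := by
    refine (hy.1.comp (f := fun t => t - τ₁) (by fun_prop) fun t ht => ?_).congr fun t _ => ?_
    · exact ⟨sub_nonneg.2 ht.1, sub_le_iff_le_add'.2 ht.2⟩
    · simp
  refine ⟨(hx.1.union_of_isClosed hcont isClosed_Icc isClosed_Icc).mono
    fun t ht => (le_total t τ₁).imp (⟨ht.1, ·⟩) (⟨·, ht.2⟩), fun t ht => ?_⟩
  rcases le_total t τ₁ with htτ | htτ
  · exact hx.2 t ⟨ht.1, htτ⟩
  · obtain ⟨ix, ex⟩ := hx.2 τ₁ ⟨hτ₁, le_rfl⟩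
    obtain ⟨iy, ey⟩ := hy.2 (t - τ₁) ⟨sub_nonneg.2 htτ, sub_le_iff_le_add'.2 ht.2⟩
    have hshift (s : ℝ) : U (-s) (K s (x s))
        = U (-τ₁) (U (-(s - τ₁)) (K (τ₁ + (s - τ₁)) (x (τ₁ + (s - τ₁))))) := by
      rw [← hU.add, add_sub_cancel]
      ring_nf
    have iy' : IntervalIntegrable (fun s => U (-s) (K s (x s))) volume τ₁ t := by
      simp only [hshift, hU.intervalIntegrable_comp_iff]
      simpa only [zero_add, sub_add_cancel] using iy.comp_sub_right τ₁
    have ey' : ∫ s in τ₁..t, U (-s) (K s (x s))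
        = U (-τ₁) (∫ s in (0 : ℝ)..(t - τ₁), U (-s) (K (τ₁ + s) (x (τ₁ + s)))) := by
      simp only [hshift]
      rw [integral_comp_sub_right
          (fun s => U (-τ₁) (U (-s) (K (τ₁ + s) (x (τ₁ + s))))) τ₁, sub_self,
        (U (-τ₁)).intervalIntegral_comp_comm iy]
    refine ⟨ix.trans iy', ?_⟩
    rw [← integral_add_adjacent_intervals ix iy', ← add_assoc, ← ex, ey', ← map_add, ← ey,
      ← hU.add, add_sub_cancel, ← neg_add, add_sub_cancel]

theorem concat [CompleteSpace X] (hU : IsOperatorGroup U) (hτ₁ : 0 ≤ τ₁) (hτ₂ : 0 ≤ τ₂)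
    (hx : IsMild U K₁ τ₁ x₀ x) (hy : IsMild U K₂ τ₂ (x τ₁) y) :
    IsMild U (fun s => if s < τ₁ then K₁ s else K₂ (s - τ₁)) (τ₁ + τ₂) x₀
      (fun t => if t ≤ τ₁ then x t else y (t - τ₁)) := by
  refine append hU hτ₁ (hx.congr (fun s hs => ?_) fun t ht => ?_) ?_
  · simp [hs.2]
  · simp [ht.2]
  · simp only [le_refl, if_true]
    refine hy.congr (fun s hs => ?_) fun t ht => ?_
    · simp [hs.1.le]
    · rcases ht.1.eq_or_lt with rfl | ht0
      · simpa using hy.apply_zero hU hτ₂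
      · simp [ht0]

theorem norm_sub_le_of_defect_le {M B a : ℝ} (hM : ∀ t ∈ Icc 0 τ, ‖U t‖ ≤ M)
    (hB : ∀ s, ‖K s‖ ≤ B) (hx : IsMild U K τ x₀ x) (hyc : ContinuousOn y (Icc 0 τ))
    (hyi : ∀ t ∈ Icc 0 τ, IntervalIntegrable (fun s => U (t - s) (K s (y s))) volume 0 t)
    (hya : ∀ t ∈ Icc 0 τ, ‖U t x₀ + (∫ s in (0 : ℝ)..t, U (t - s) (K s (y s))) - y t‖ ≤ a) :
    ∀ t ∈ Icc 0 τ, ‖x t - y t‖ ≤ a * Real.exp (M * B * t) := by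
  intro t₀ ht₀
  have hM0 : 0 ≤ M := (norm_nonneg _).trans (hM t₀ ht₀)
  have hB0 : 0 ≤ B := (norm_nonneg _).trans (hB 0)
  have hcont : ContinuousOn (fun t => ‖x t - y t‖) (Icc 0 τ) := (hx.continuousOn.sub hyc).norm
  refine le_mul_exp_of_le_add_integral (by positivity) hcont (fun t ht => ?_) t₀ ht₀
  obtain ⟨hxi, hxt⟩ := hx.duhamel t ht
  have hsplit : x t - y t = (U t x₀ + (∫ s in (0 : ℝ)..t, U (t - s) (K s (y s))) - y t)
      + ∫ s in (0 : ℝ)..t, U (t - s) (K s (x s - y s)) := by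
    simp only [map_sub]
    rw [integral_sub hxi (hyi t ht), hxt]
    abel
  rw [hsplit, ← intervalIntegral.integral_const_mul]
  refine norm_add_le_of_le (hya t ht) (norm_integral_le_of_norm_le ht.1 (.of_forall fun s hs => ?_)
    ((hcont.mono (Icc_subset_Icc_right ht.2)).intervalIntegrable_of_Icc ht.1 |>.const_mul _))
  calc ‖U (t - s) (K s (x s - y s))‖
      ≤ M * ‖K s (x s - y s)‖ := (U (t - s)).le_of_opNorm_le
        (hM _ ⟨sub_nonneg.2 hs.2, by linarith [hs.1, ht.2]⟩) _
    _ ≤ M * (B * ‖x s - y s‖) := by gcongr; exact (K s).le_of_opNorm_le (hB s) _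
    _ = M * B * ‖x s - y s‖ := by ring

theorem norm_sub_le {M B : ℝ} (hM : ∀ t ∈ Icc 0 τ, ‖U t‖ ≤ M) (hB : ∀ s, ‖K s‖ ≤ B)
    (hx : IsMild U K τ x₀ x) (hy : IsMild U K τ y₀ y) :
    ∀ t ∈ Icc 0 τ, ‖x t - y t‖ ≤ M * ‖x₀ - y₀‖ * Real.exp (M * B * t) := by
  refine norm_sub_le_of_defect_le hM hB hx hy.continuousOn (fun t ht => (hy.duhamel t ht).1)
    fun t ht => ?_
  rw [(hy.duhamel t ht).2, add_sub_add_right_eq_sub, ← map_sub]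
  exact (U t).le_of_opNorm_le (hM t ht) _

end IsMild

theorem exists_continuousOn_eq_add_integral [CompleteSpace X] {F : ℝ → X →L[ℝ] X} {C : NNReal}
    {δ : ℝ} (hδ : 0 ≤ δ) (hF : ∀ y, ContinuousOn (fun t => F t y) (Icc 0 δ))
    (hC : ∀ t ∈ Icc 0 δ, ‖F t‖ ≤ C) (hCδ : C * δ ≤ 1 / 2) (x₀ : X) :
    ∃ z : ℝ → X, ContinuousOn z (Icc 0 δ) ∧ ∀ t ∈ Icc 0 δ,
      IntervalIntegrable (fun s => F s (z s)) volume 0 t ∧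
      z t = x₀ + ∫ s in (0 : ℝ)..t, F s (z s) := by
  have hPL : IsPicardLindelof (tmin := 0) (tmax := δ) (fun t z => F t z)
      ⟨0, le_rfl, hδ⟩ x₀ (‖x₀‖₊ + 1) 0 (C * (2 * ‖x₀‖₊ + 1)) C := by
    refine ⟨fun t ht => ((F t).lipschitz.weaken (hC t ht)).lipschitzOnWith, fun z _ => hF z,
      fun t ht z hz => ?_, ?_⟩
    · have hzx : ‖z - x₀‖ ≤ ‖x₀‖ + 1 := by simpa using mem_closedBall_iff_norm.1 hz
      push_cast
      refine (F t).le_of_opNorm_le_of_le (hC t ht) ?_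
      linarith [norm_sub_norm_le z x₀]
    · simp only [sub_zero, sub_self, max_eq_left hδ]
      push_cast
      nlinarith [norm_nonneg x₀]
  obtain ⟨z, hz0, hz⟩ := hPL.exists_eq_forall_mem_Icc_hasDerivWithinAt₀
  have hzc : ContinuousOn z (Icc 0 δ) := fun t ht => (hz t ht).continuousWithinAt
  have hFz : ContinuousOn (fun t => F t (z t)) (Icc 0 δ) := fun t ht =>
    tendsto_clm_apply (eventually_mem_nhdsWithin.mono hC) (hF _ t ht) (hzc t ht)
  refine ⟨z, hzc, fun t ht => ?_⟩
  have hsub : Icc 0 t ⊆ Icc 0 δ := Icc_subset_Icc_right ht.2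
  have hint : IntervalIntegrable (fun s => F s (z s)) volume 0 t :=
    (hFz.mono hsub).intervalIntegrable_of_Icc ht.1
  refine ⟨hint, ?_⟩
  rw [integral_eq_sub_of_hasDerivAt_of_le ht.1 (hzc.mono hsub) (fun s hs =>
    (hz s (hsub (Ioo_subset_Icc_self hs))).hasDerivAt
      (Icc_mem_nhds hs.1 (hs.2.trans_le ht.2))) hint]
  simp [hz0]

theorem exists_isMild_of_small [CompleteSpace X] (hU : IsOperatorGroup U) (K : X →L[ℝ] X) :
    ∃ δ > 0, ∀ x₀, ∃ x, IsMild U (fun _ => K) δ x₀ x := by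
  obtain ⟨M, hM⟩ := hU.exists_norm_le (-1) 1
  have hM0 : 0 ≤ M := (norm_nonneg _).trans (hM 0 (by norm_num))
  set C : NNReal := ⟨M * (‖K‖ * M), by positivity⟩
  set δ : ℝ := min 1 (1 / (2 * (C + 1)))
  have hδ : 0 < δ := by positivity
  have hδ1 : δ ≤ 1 := min_le_left _ _
  have hCδ : C * δ ≤ 1 / 2 := by
    have hle : δ * (2 * (C + 1)) ≤ 1 := (le_div_iff₀ (by positivity)).1 (min_le_right _ _)
    nlinarith
  have hcont {z : ℝ → X} (hz : ContinuousOn z (Icc 0 δ)) :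
      ContinuousOn (fun t => U t (z t)) (Icc 0 δ) := hU.continuousOn_apply continuousOn_id hz
  refine ⟨δ, hδ, fun x₀ => ?_⟩
  obtain ⟨z, hzc, hz⟩ := exists_continuousOn_eq_add_integral (F := fun t => U (-t) ∘L K ∘L U t)
    (C := C) hδ.le
    (fun y => hU.continuousOn_apply continuousOn_neg
      (K.continuous.comp_continuousOn (hcont continuousOn_const)))
    (fun t ht => (ContinuousLinearMap.opNorm_comp_le _ _).trans (mul_le_mul
      (hM _ ⟨by linarith [ht.2], by linarith [ht.1]⟩)
      ((ContinuousLinearMap.opNorm_comp_le _ _).trans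
        (by gcongr; exact hM _ ⟨by linarith [ht.1], ht.2.trans hδ1⟩))
      (norm_nonneg _) hM0)) hCδ x₀
  refine ⟨fun t => U t (z t), (isMild_iff hU).2 ⟨hcont hzc, fun t ht => ?_⟩⟩
  simpa only [hU.neg_apply_apply, ContinuousLinearMap.comp_apply] using hz t ht

theorem exists_isMild [CompleteSpace X] (hU : IsOperatorGroup U) (K : X →L[ℝ] X) (τ : ℝ) (x₀ : X) :
    ∃ x, IsMild U (fun _ => K) τ x₀ x := by
  obtain ⟨δ, hδ, hsmall⟩ := exists_isMild_of_small hU K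
  have hsteps (n : ℕ) : ∃ x, IsMild U (fun _ => K) (n * δ) x₀ x := by
    induction n with
    | zero =>
      obtain ⟨x, hx⟩ := hsmall x₀
      exact ⟨x, hx.mono (by simpa using hδ.le)⟩
    | succ n ih =>
      obtain ⟨x, hx⟩ := ih
      obtain ⟨y, hy⟩ := hsmall (x (n * δ))
      have h := hx.concat hU (by positivity) hδ.le hy
      simp only [ite_self, ← add_one_mul, ← Nat.cast_add_one] at h
      exact ⟨_, h⟩
  obtain ⟨n, hn⟩ := exists_nat_ge (τ / δ)
  obtain ⟨x, hx⟩ := hsteps n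
  exact ⟨x, hx.mono ((div_le_iff₀ hδ).1 hn)⟩

theorem norm_integral_inv_smul_sub_le [CompleteSpace X] {g : ℝ → X} {z : X} {t δ η : ℝ}
    (hδ : 0 < δ) (ht : t ∈ Icc 0 δ) (hgi : IntervalIntegrable g volume 0 t)
    (hg : ∀ s ∈ Icc 0 t, ‖g s - z‖ ≤ η) :
    ‖(∫ s in (0 : ℝ)..t, δ⁻¹ • g s) - (t / δ) • z‖ ≤ η := by
  have hη : 0 ≤ η := (norm_nonneg _).trans (hg t ⟨ht.1, le_rfl⟩)
  have hsplit : (∫ s in (0 : ℝ)..t, δ⁻¹ • g s) - (t / δ) • z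
      = δ⁻¹ • ∫ s in (0 : ℝ)..t, (g s - z) := by
    rw [integral_sub hgi intervalIntegrable_const, intervalIntegral.integral_const,
      intervalIntegral.integral_smul, smul_sub,
      smul_smul, sub_zero, div_eq_inv_mul]
  rw [hsplit, norm_smul_of_nonneg (by positivity), inv_mul_le_iff₀ hδ]
  calc ‖∫ s in (0 : ℝ)..t, (g s - z)‖ ≤ η * |t - 0| := norm_integral_le_of_norm_le_const
        fun s hs => hg s (Ioc_subset_Icc_self (by rwa [uIoc_of_le ht.1] at hs))
    _ ≤ η * δ := by rw [sub_zero, abs_of_nonneg ht.1]; gcongr; exact ht.2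
    _ = δ * η := mul_comm _ _

/-- The impulsive control `δ⁻¹ K` acting during a time `δ` is compared with the affine curve
`t ↦ x₀ + (t / δ) K x₀`, along which `K` is constant. -/
theorem IsMild.norm_sub_impulse_le [CompleteSpace X] (hU : IsOperatorGroup U) {K : X →L[ℝ] X}
    {δ M η : ℝ} {x₀ : X} {x : ℝ → X} (hδ : 0 < δ) (hM : ∀ t ∈ Icc 0 δ, ‖U t‖ ≤ M)
    (hK : K (K x₀) = 0) (hη : ∀ t ∈ Icc 0 δ, ‖U t x₀ - x₀‖ ≤ η)
    (hη' : ∀ t ∈ Icc 0 δ, ‖U t (K x₀) - K x₀‖ ≤ η) (hx : IsMild U (fun _ => δ⁻¹ • K) δ x₀ x) :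
    ‖x δ - (x₀ + K x₀)‖ ≤ 2 * η * Real.exp (M * ‖K‖) := by
  set y : ℝ → X := fun t => x₀ + (t / δ) • K x₀ with hy
  have hKy (s t : ℝ) : U (t - s) ((δ⁻¹ • K) (y s)) = δ⁻¹ • U (t - s) (K x₀) := by simp [y, hK]
  have hint (t : ℝ) : IntervalIntegrable (fun s => U (t - s) (K x₀)) volume 0 t :=
    ((hU.continuous_apply _).comp (continuous_sub_left t)).intervalIntegrable _ _
  have hdefect : ∀ t ∈ Icc 0 δ,
      ‖U t x₀ + (∫ s in (0 : ℝ)..t, U (t - s) ((δ⁻¹ • K) (y s))) - y t‖ ≤ 2 * η := by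
    intro t ht
    simp only [hKy]
    rw [hy, add_sub_add_comm, two_mul]
    refine norm_add_le_of_le (hη t ht)
      (norm_integral_inv_smul_sub_le hδ ht (hint t) fun s hs => hη' _ ?_)
    exact ⟨sub_nonneg.2 hs.2, by linarith [hs.1, ht.2]⟩
  have h := hx.norm_sub_le_of_defect_le hM (fun _ => le_rfl) (by fun_prop)
    (fun t _ => by simpa only [hKy] using! (hint t).smul δ⁻¹) hdefect δ ⟨hδ.le, le_rfl⟩
  have hexp : M * ‖δ⁻¹ • K‖ * δ = M * ‖K‖ := by
    rw [norm_smul, Real.norm_of_nonneg (by positivity)]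
    field_simp
  have hyδ : y δ = x₀ + K x₀ := by simp [y, hδ.ne']
  rwa [hexp, hyδ] at h

theorem IsMild.tendsto_impulse [CompleteSpace X] (hU : IsOperatorGroup U) {K : X →L[ℝ] X}
    {x₀ : X} {x : ℝ → ℝ → X} (hK : K (K x₀) = 0)
    (hx : ∀ δ > 0, IsMild U (fun _ => δ⁻¹ • K) δ x₀ (x δ)) :
    Tendsto (fun δ => x δ δ) (𝓝[>] 0) (𝓝 (x₀ + K x₀)) := by
  obtain ⟨M, hM⟩ := hU.exists_norm_le (-1) 1
  rw [Metric.tendsto_nhds]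
  intro ε hε
  set η := ε / (4 * Real.exp (M * ‖K‖)) with hη
  have hη0 : 0 < η := by positivity
  have hsmall (z : X) : ∀ᶠ t in 𝓝 0, ‖U t z - z‖ ≤ η := by
    have h := (hU.continuous_apply z).tendsto 0
    rw [hU.zero] at h
    exact (Metric.tendsto_nhds.1 h η hη0).mono fun t ht => (dist_eq_norm (U t z) z ▸ ht).le
  have hnear {P : ℝ → Prop} (hP : ∀ᶠ t in 𝓝 0, P t) :
      ∀ᶠ δ in 𝓝[>] (0 : ℝ), ∀ t ∈ Icc 0 δ, P t :=
    (tendsto_const_nhds.Icc (tendsto_id'.2 nhdsWithin_le_nhds)).eventually hP.smallSets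
  have hbound : ∀ᶠ t in 𝓝 0, ‖U t‖ ≤ M :=
    mem_of_superset (Icc_mem_nhds (by norm_num) (by norm_num)) hM
  filter_upwards [hnear hbound, hnear (hsmall x₀), hnear (hsmall (K x₀)), self_mem_nhdsWithin]
    with δ h₁ h₂ h₃ hδ
  rw [dist_eq_norm]
  calc _ ≤ 2 * η * Real.exp (M * ‖K‖) :=
        IsMild.norm_sub_impulse_le hU hδ h₁ hK h₂ h₃ (hx δ hδ)
    _ = ε / 2 := by rw [hη]; field_simp; norm_num
    _ < ε := half_lt_self hε

end MildSolutions

/-! ### Reachability for bilinear control systems -/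

section Reachability

theorem IsPiecewiseConstant.concat {E : Type*} {τ₁ τ₂ : ℝ} {p₁ p₂ : ℝ → E}
    (h₁ : IsPiecewiseConstant τ₁ p₁) (h₂ : IsPiecewiseConstant τ₂ p₂) :
    IsPiecewiseConstant (τ₁ + τ₂) (fun s => if s < τ₁ then p₁ s else p₂ (s - τ₁)) := by
  obtain ⟨n₁, t₁, ht₁, ht₁0, rfl, hp₁⟩ := h₁
  obtain ⟨n₂, t₂, ht₂, ht₂0, rfl, hp₂⟩ := h₂
  refine ⟨n₁ + n₂, fun i => t₁ (min i n₁) + t₂ (i - n₁), fun i j hij => ?_, by simp [ht₁0, ht₂0],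
    by simp, fun i hi => ?_⟩
  · exact add_le_add (ht₁ (by gcongr)) (ht₂ (by omega))
  · rcases lt_or_ge i n₁ with hin | hin
    · obtain ⟨c, hc⟩ := hp₁ i hin
      have hends : min i n₁ = i ∧ min (i + 1) n₁ = i + 1 ∧ i - n₁ = 0 ∧ i + 1 - n₁ = 0 := by omega
      refine ⟨c, fun s hs => ?_⟩
      simp only [hends, ht₂0, add_zero] at hs
      exact (if_pos (hs.2.trans_le (ht₁ hin))).trans (hc s hs)
    · obtain ⟨c, hc⟩ := hp₂ (i - n₁) (by omega)
      have hends : min i n₁ = n₁ ∧ min (i + 1) n₁ = n₁ ∧ i + 1 - n₁ = i - n₁ + 1 := by omega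
      refine ⟨c, fun s hs => ?_⟩
      simp only [hends] at hs
      have hpos : t₂ 0 ≤ t₂ (i - n₁) := ht₂ (Nat.zero_le _)
      exact (if_neg (by linarith [hs.1])).trans
        (hc _ ⟨by linarith [hs.1], by linarith [hs.2]⟩)

theorem isPiecewiseConstant_const {E : Type*} {τ : ℝ} (hτ : 0 ≤ τ) (c : E) :
    IsPiecewiseConstant τ (fun _ => c) :=
  ⟨1, fun i => if i = 0 then 0 else τ, monotone_nat_of_le_succ fun i => by
    split_ifs <;> simp_all, by simp, by simp, fun _ _ => ⟨c, fun _ _ => rfl⟩⟩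

variable {X E : Type*} [NormedAddCommGroup X] [NormedSpace ℝ X] [NormedAddCommGroup E]
  [NormedSpace ℝ E] {U : ℝ → X →L[ℝ] X} {K : E →L[ℝ] X →L[ℝ] X}

/-- `Φ` is the flow, from time `0` to time `τ`, of `x' = A x + K(p(t)) x` for some bounded piecewise
constant control `p`; here `A` is the generator of `U`. The control is the same for all initial
states, so that flows can be composed. -/
def IsPropagator (U : ℝ → X →L[ℝ] X) (K : E →L[ℝ] X →L[ℝ] X) (τ : ℝ) (Φ : X → X) : Prop :=
  0 ≤ τ ∧ ∃ p : ℝ → E, IsPiecewiseConstant τ p ∧ Bornology.IsBounded (range p) ∧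
    ∀ x₀, ∃ x, IsMild U (fun s => K (p s)) τ x₀ x ∧ x τ = Φ x₀

theorem IsMild.exists_norm_sub_le_mul [CompleteSpace X] (hU : IsOperatorGroup U) {p : ℝ → E}
    (hp : Bornology.IsBounded (range p)) {τ : ℝ} (hτ : 0 ≤ τ) :
    ∃ C, ∀ x₀ y₀ x y, IsMild U (fun s => K (p s)) τ x₀ x → IsMild U (fun s => K (p s)) τ y₀ y →
      ‖x τ - y τ‖ ≤ C * ‖x₀ - y₀‖ := by
  obtain ⟨M, hM⟩ := hU.exists_norm_le 0 τ
  obtain ⟨R, hR⟩ := hp.exists_norm_le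
  refine ⟨M * Real.exp (M * (‖K‖ * R) * τ), fun x₀ y₀ x y hx hy => ?_⟩
  rw [mul_right_comm]
  exact hx.norm_sub_le hM (fun s => K.le_of_opNorm_le_of_le le_rfl (hR _ (mem_range_self s)))
    hy τ ⟨hτ, le_rfl⟩

namespace IsPropagator

variable {τ τ₁ τ₂ : ℝ} {Φ Φ₁ Φ₂ : X → X}

theorem continuous [CompleteSpace X] (hU : IsOperatorGroup U) (h : IsPropagator U K τ Φ) :
    Continuous Φ := by
  obtain ⟨hτ, p, -, hb, hΦ⟩ := h
  obtain ⟨C, hC⟩ := IsMild.exists_norm_sub_le_mul (K := K) hU hb hτ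
  refine (LipschitzWith.of_dist_le' (K := C) fun x₀ y₀ => ?_).continuous
  obtain ⟨x, hx, hxΦ⟩ := hΦ x₀
  obtain ⟨y, hy, hyΦ⟩ := hΦ y₀
  simpa only [dist_eq_norm, hxΦ, hyΦ] using hC x₀ y₀ x y hx hy

theorem comp [CompleteSpace X] (hU : IsOperatorGroup U) (h₁ : IsPropagator U K τ₁ Φ₁)
    (h₂ : IsPropagator U K τ₂ Φ₂) : IsPropagator U K (τ₁ + τ₂) (Φ₂ ∘ Φ₁) := by
  obtain ⟨hτ₁, p₁, hp₁, hb₁, hΦ₁⟩ := h₁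
  obtain ⟨hτ₂, p₂, hp₂, hb₂, hΦ₂⟩ := h₂
  refine ⟨add_nonneg hτ₁ hτ₂, _, hp₁.concat hp₂, (hb₁.union hb₂).subset ?_, fun x₀ => ?_⟩
  · rintro _ ⟨s, rfl⟩
    dsimp only
    split_ifs
    · exact .inl (mem_range_self _)
    · exact .inr (mem_range_self _)
  · obtain ⟨x, hx, hxΦ⟩ := hΦ₁ x₀
    obtain ⟨y, hy, hyΦ⟩ := hΦ₂ (x τ₁)
    refine ⟨_, (hx.concat hU hτ₁ hτ₂ hy).congr (fun s _ => ?_) fun _ _ => rfl, ?_⟩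
    · exact (apply_ite K _ _ _).symm
    · rcases hτ₂.eq_or_lt with rfl | hτ₂'
      · simpa [← hxΦ, ← hyΦ] using (hy.apply_zero hU le_rfl).symm
      · simp [hτ₂', hyΦ, hxΦ]

theorem of_const {q : E} {x : X → ℝ → X} (hτ : 0 ≤ τ)
    (hx : ∀ x₀, IsMild U (fun _ => K q) τ x₀ (x x₀)) : IsPropagator U K τ (fun x₀ => x x₀ τ) :=
  ⟨hτ, fun _ => q, isPiecewiseConstant_const hτ q,
    Bornology.isBounded_singleton.subset range_const_subset, fun x₀ => ⟨x x₀, hx x₀, rfl⟩⟩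

theorem free (hU : IsOperatorGroup U) (hτ : 0 ≤ τ) : IsPropagator U K τ (U τ) :=
  of_const (q := 0) (x := fun x₀ t => U t x₀) hτ fun x₀ =>
    ⟨(hU.continuous_apply x₀).continuousOn, fun t _ => by simp⟩

end IsPropagator

/-- States reached from `x` in time less than `T` by means of piecewise constant controls. -/
def reachableSet (U : ℝ → X →L[ℝ] X) (K : E →L[ℝ] X →L[ℝ] X) (T : ℝ) (x : X) : Set X :=
  {y | ∃ τ < T, ∃ Φ, IsPropagator U K τ Φ ∧ Φ x = y}

theorem mem_closure_reachableSet_trans [CompleteSpace X] (hU : IsOperatorGroup U) {S T : ℝ}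
    {x y z : X} (hxy : y ∈ closure (reachableSet U K S x))
    (hyz : z ∈ closure (reachableSet U K T y)) : z ∈ closure (reachableSet U K (S + T) x) := by
  refine closure_minimal ?_ isClosed_closure hyz
  rintro _ ⟨τ, hτ, Φ, hΦ, rfl⟩
  refine map_mem_closure (hΦ.continuous hU) hxy ?_
  rintro _ ⟨σ, hσ, Ψ, hΨ, rfl⟩
  exact ⟨σ + τ, add_lt_add hσ hτ, Φ ∘ Ψ, hΨ.comp hU hΦ, rfl⟩

theorem exists_control_of_mem_closure_reachableSet [CompleteSpace X] (hU : IsOperatorGroup U)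
    {T ε : ℝ} (hε : 0 < ε) {x₀ y : X} (hy : y ∈ closure (reachableSet U K T x₀)) :
    ∃ τ ∈ Ico 0 T, ∃ p, IsPiecewiseConstant τ p ∧
      (∃ x, IsMild U (fun s => K (p s)) τ x₀ x) ∧
      ∀ x, IsMild U (fun s => K (p s)) τ x₀ x → ‖x τ - y‖ < ε := by
  obtain ⟨_, ⟨τ, hτT, Φ, ⟨hτ, p, hp, hb, hΦ⟩, rfl⟩, hdist⟩ := Metric.mem_closure_iff.1 hy ε hε
  obtain ⟨C, hC⟩ := IsMild.exists_norm_sub_le_mul (K := K) hU hb hτ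
  obtain ⟨x', hx', hxΦ⟩ := hΦ x₀
  refine ⟨τ, ⟨hτ, hτT⟩, p, hp, ⟨x', hx'⟩, fun x hx => ?_⟩
  have huniq : x τ = x' τ := by
    simpa [sub_eq_zero] using hC x₀ x₀ x x' hx hx'
  rwa [huniq, hxΦ, ← dist_eq_norm, dist_comm]

/-- Small-time approximate reachability: `y` can be approximated, in arbitrarily small time, by
states reached from `x`. -/
def SmallTimeReachable (U : ℝ → X →L[ℝ] X) (K : E →L[ℝ] X →L[ℝ] X) (x y : X) : Prop :=
  ∀ T > 0, y ∈ closure (reachableSet U K T x)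

namespace SmallTimeReachable

variable {x y z : X}

theorem refl (hU : IsOperatorGroup U) (x : X) : SmallTimeReachable U K x x := fun T hT =>
  subset_closure ⟨0, hT, U 0, .free hU le_rfl, by simp [hU.zero]⟩

theorem trans [CompleteSpace X] (hU : IsOperatorGroup U) (hxy : SmallTimeReachable U K x y)
    (hyz : SmallTimeReachable U K y z) : SmallTimeReachable U K x z := fun T hT => by
  simpa only [add_halves] using
    mem_closure_reachableSet_trans hU (hxy _ (half_pos hT)) (hyz _ (half_pos hT))

theorem isClosed_setOf (x : X) : IsClosed {y | SmallTimeReachable U K x y} := by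
  simp only [SmallTimeReachable, ofPred_forall]
  exact isClosed_biInter fun T _ => isClosed_closure

theorem of_tendsto [CompleteSpace X] (hU : IsOperatorGroup U) {ι : Type*} {l : Filter ι} [l.NeBot]
    {r : ι → ℝ} {a c : ι → X} (hr : Tendsto r l (𝓝[≥] 0))
    (hxa : ∀ᶠ i in l, SmallTimeReachable U K x (a i))
    (hac : ∀ᶠ i in l, SmallTimeReachable U K (U (r i) (a i)) (c i))
    (hc : Tendsto c l (𝓝 y)) : SmallTimeReachable U K x y := by
  intro T hT
  have hT3 : 0 < T / 3 := by positivity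
  obtain ⟨hr0, hr_nonneg⟩ := tendsto_nhdsWithin_iff.1 hr
  refine isClosed_closure.mem_of_tendsto hc ?_
  filter_upwards [hxa, hac, hr_nonneg, hr0.eventually (gt_mem_nhds hT3)] with i hxi hci h0 hlt
  have hfree : U (r i) (a i) ∈ closure (reachableSet U K (T / 3) (a i)) :=
    subset_closure ⟨r i, hlt, U (r i), .free hU h0, rfl⟩
  have h := mem_closure_reachableSet_trans hU
    (mem_closure_reachableSet_trans hU (hxi _ hT3) hfree) (hci _ hT3)
  rwa [add_thirds] at h

theorem add_of_sq_eq_zero [CompleteSpace X] (hU : IsOperatorGroup U) {q : E}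
    (hq : K q (K q x) = 0) : SmallTimeReachable U K x (x + K q x) := by
  choose ξ hξ using fun (δ : ℝ) (x₀ : X) => exists_isMild hU (K (δ⁻¹ • q)) δ x₀
  intro T hT
  refine mem_closure_of_tendsto (f := fun δ => ξ δ x δ)
    (IsMild.tendsto_impulse hU hq fun δ _ => by simpa only [map_smul] using hξ δ x) ?_
  filter_upwards [Ioo_mem_nhdsGT hT] with δ hδ
  exact ⟨δ, hδ.2, _, .of_const hδ.1.le (hξ δ), rfl⟩

end SmallTimeReachable

end Reachability

/-! ### Fourier series on the torus -/

section Characters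

variable {d : ℕ}

/-- The character `x ↦ e^{ik·x}` of the torus. -/
def expo (k : Fin d → ℤ) : C(Torus d, ℂ) where
  toFun x := ∏ i, fourier (k i) (x i)

theorem expo_add (k m : Fin d → ℤ) (x : Torus d) : expo (k + m) x = expo k x * expo m x := by
  simp only [expo, Pi.add_apply, fourier_add, ContinuousMap.coe_mk, ← Finset.prod_mul_distrib]

theorem expo_neg (k : Fin d → ℤ) (x : Torus d) : expo (-k) x = conj (expo k x) := by
  simp only [expo, Pi.neg_apply, fourier_neg, ContinuousMap.coe_mk, map_prod]

theorem expo_zero (x : Torus d) : expo 0 x = 1 := by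
  simp [expo]

theorem expo_single (i : Fin d) (x : Torus d) : expo (Pi.single i 1) x = fourier 1 (x i) := by
  simp only [expo, ContinuousMap.coe_mk]
  rw [Finset.prod_eq_single i (fun j _ hj => by simp [Pi.single_eq_of_ne hj]) (by simp),
    Pi.single_eq_same]

theorem expo_mul_conj (k : Fin d → ℤ) (x : Torus d) : expo k x * conj (expo k x) = 1 := by
  rw [← expo_neg, ← expo_add, add_neg_cancel, expo_zero]

theorem expo_ne_zero (k : Fin d → ℤ) (x : Torus d) : expo k x ≠ 0 :=
  left_ne_zero_of_mul_eq_one (expo_mul_conj k x)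

variable (d) in
/-- The star algebra of continuous functions generated by the characters, to which the
Stone–Weierstrass theorem applies. -/
def expoSubalgebra : StarSubalgebra ℂ C(Torus d, ℂ) where
  toSubalgebra := Algebra.adjoin ℂ (range expo)
  star_mem' := by
    change Algebra.adjoin ℂ (range expo) ≤ star (Algebra.adjoin ℂ (range expo))
    refine Algebra.adjoin_le ?_
    rintro _ ⟨k, rfl⟩
    refine Algebra.subset_adjoin ⟨-k, ?_⟩
    ext1 x
    simp only [expo_neg, starRingEnd_apply, ContinuousMap.star_apply]

theorem expoSubalgebra_coe :
    Subalgebra.toSubmodule (expoSubalgebra d).toSubalgebra = Submodule.span ℂ (range expo) := by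
  refine Algebra.adjoin_eq_span_of_subset _ ?_
  refine .trans (fun x ↦ Submonoid.closure_induction (fun _ ↦ id) ⟨0, ?_⟩ ?_)
    Submodule.subset_span
  · ext x
    simp [expo_zero]
  · rintro _ _ _ _ ⟨k, rfl⟩ ⟨m, rfl⟩
    refine ⟨k + m, ?_⟩
    ext x
    simp [expo_add]

theorem expoSubalgebra_separatesPoints : (expoSubalgebra d).SeparatesPoints := by
  intro x y hxy
  obtain ⟨i, hi⟩ := Function.ne_iff.1 hxy
  refine ⟨_, ⟨expo (Pi.single i 1), Algebra.subset_adjoin ⟨Pi.single i 1, rfl⟩, rfl⟩, ?_⟩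
  change expo (Pi.single i 1) x ≠ expo (Pi.single i 1) y
  rw [expo_single, expo_single, fourier_one, fourier_one]
  contrapose hi
  exact AddCircle.injective_toCircle Real.two_pi_pos.ne' (Circle.ext hi)

theorem span_expo_closure_eq_top :
    (Submodule.span ℂ (range (expo (d := d)))).topologicalClosure = ⊤ := by
  rw [← expoSubalgebra_coe]
  exact congrArg (Subalgebra.toSubmodule <| StarSubalgebra.toSubalgebra ·)
    (ContinuousMap.starSubalgebra_topologicalClosure_eq_top_of_separatesPoints _
      expoSubalgebra_separatesPoints)

/-- The normalization constant `(2π)^{-d/2}` of the eigenfunctions `φ_k`. -/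
def normConst (d : ℕ) : ℝ := (2 * Real.pi) ^ (-(d : ℝ) / 2)

theorem normConst_ne_zero (d : ℕ) : normConst d ≠ 0 :=
  (Real.rpow_pos_of_pos Real.two_pi_pos _).ne'

theorem phi_apply (k : Fin d → ℤ) (x : Torus d) : phi k x = (normConst d : ℂ) * expo k x := rfl

theorem phi_neg (k : Fin d → ℤ) (x : Torus d) : phi (-k) x = conj (phi k x) := by
  simp [phi_apply, expo_neg]

theorem phi_mul_conj_phi (k j : Fin d → ℤ) (x : Torus d) :
    phi j x * conj (phi k x) = (normConst d : ℂ) * phi (j - k) x := by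
  simp only [phi_apply, sub_eq_add_neg, expo_add, expo_neg, map_mul, Complex.conj_ofReal]
  ring

theorem measureReal_univ_torus : (volume : Measure (Torus d)).real univ = (2 * Real.pi) ^ d := by
  rw [Measure.real, ← Set.pi_univ (univ : Set (Fin d)), volume_pi_pi]
  simp [AddCircle.measure_univ, ENNReal.toReal_ofReal Real.pi_pos.le]

theorem normConst_mul_integral_phi_zero : (normConst d : ℂ) * ∫ x, phi (0 : Fin d → ℤ) x = 1 := by
  have hsq : normConst d * normConst d * (2 * Real.pi) ^ d = 1 := by
    rw [normConst, ← Real.rpow_add Real.two_pi_pos, ← Real.rpow_natCast,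
      ← Real.rpow_add Real.two_pi_pos]
    ring_nf
    simp
  simp only [phi_apply, expo_zero, mul_one, integral_const, Complex.real_smul,
    measureReal_univ_torus]
  norm_cast
  linarith

end Characters

section FourierBasis

variable {d : ℕ}

/-- `φ_k` as an element of `L²(𝕋ᵈ, ℂ)`. -/
def phiLp (k : Fin d → ℤ) : Lp ℂ 2 (volume : Measure (Torus d)) :=
  ContinuousMap.toLp 2 volume ℂ (phi k)

theorem coeFn_phiLp (k : Fin d → ℤ) : phiLp k =ᵐ[volume] phi k :=
  ContinuousMap.coeFn_toLp (p := 2) (𝕜 := ℂ) volume (phi k)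

theorem orthonormal_phiLp : Orthonormal ℂ (phiLp (d := d)) := by
  rw [orthonormal_iff_ite]
  intro k j
  rw [phiLp, phiLp, ContinuousMap.inner_toLp]
  simp only [phi_mul_conj_phi, integral_const_mul]
  split_ifs with h
  · rw [h, sub_self, normConst_mul_integral_phi_zero]
  · rw [integral_phi (sub_ne_zero.2 (Ne.symm h)), mul_zero]

theorem span_phiLp_closure_eq_top :
    (Submodule.span ℂ (range (phiLp (d := d)))).topologicalClosure = ⊤ := by
  have hexpo := (ContinuousMap.toLp_denseRange ℂ (volume : Measure (Torus d)) ℂ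
    (p := 2) (by simp)).topologicalClosure_map_submodule span_expo_closure_eq_top
  rw [Submodule.map_span, ← range_comp] at hexpo
  rw [eq_top_iff, ← hexpo]
  refine Submodule.topologicalClosure_mono (Submodule.span_le.2 ?_)
  rintro _ ⟨k, rfl⟩
  have hk : expo k = (normConst d : ℂ)⁻¹ • phi k := by
    ext x
    simp [phi_apply, normConst_ne_zero]
  simp only [Function.comp_apply, hk, map_smul]
  exact Submodule.smul_mem _ _ (Submodule.subset_span ⟨k, rfl⟩)

/-- The Hilbert basis `(φ_k)` of `L²(𝕋ᵈ, ℂ)`. -/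
def phiBasis (d : ℕ) : HilbertBasis (Fin d → ℤ) ℂ (Lp ℂ 2 (volume : Measure (Torus d))) :=
  HilbertBasis.mk orthonormal_phiLp span_phiLp_closure_eq_top.ge

theorem phiBasis_apply (k : Fin d → ℤ) : phiBasis d k = phiLp k := by
  rw [phiBasis, HilbertBasis.coe_mk]

theorem integrable_mul_conj_phi (g : Lp ℂ 2 (volume : Measure (Torus d))) (k : Fin d → ℤ) :
    Integrable fun x => g x * conj (phi k x) := by
  refine (L2.integrable_inner (𝕜 := ℂ) (phiLp k) g).congr ?_
  filter_upwards [coeFn_phiLp k] with x hx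
  rw [hx, RCLike.inner_apply]

theorem phiBasis_repr (g : Lp ℂ 2 (volume : Measure (Torus d))) (k : Fin d → ℤ) :
    (phiBasis d).repr g k = ∫ x, g x * conj (phi k x) := by
  rw [HilbertBasis.repr_apply_apply, phiBasis_apply, L2.inner_def]
  refine integral_congr_ae ?_
  filter_upwards [coeFn_phiLp k] with x hx
  rw [hx, RCLike.inner_apply]

/-- The inclusion `L²(𝕋ᵈ, ℝ) → L²(𝕋ᵈ, ℂ)`. -/
def toComplex (d : ℕ) : L2 d →L[ℝ] Lp ℂ 2 (volume : Measure (Torus d)) :=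
  Complex.ofRealCLM.compLpL 2 volume

/-- The real part `L²(𝕋ᵈ, ℂ) → L²(𝕋ᵈ, ℝ)`. -/
def toReal (d : ℕ) : Lp ℂ 2 (volume : Measure (Torus d)) →L[ℝ] L2 d :=
  Complex.reCLM.compLpL 2 volume

theorem coeFn_toComplex (f : L2 d) : toComplex d f =ᵐ[volume] fun x => (f x : ℂ) :=
  Complex.ofRealCLM.coeFn_compLpL f

theorem coeFn_toReal (g : Lp ℂ 2 (volume : Measure (Torus d))) :
    toReal d g =ᵐ[volume] fun x => (g x).re :=
  Complex.reCLM.coeFn_compLpL g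

theorem coeFn_mode (k : Fin d → ℤ) (c : ℂ) : mode k c =ᵐ[volume] fun x => (c * phi k x).re :=
  ContinuousMap.coeFn_toLp (p := 2) (𝕜 := ℝ) volume (modeFun k c)

theorem norm_toComplex (f : L2 d) : ‖toComplex d f‖ = ‖f‖ := by
  refine le_antisymm (Lp.norm_le_norm_of_ae_le ?_) (Lp.norm_le_norm_of_ae_le ?_) <;>
  · filter_upwards [coeFn_toComplex f] with x hx
    simp [hx]

theorem toReal_toComplex (f : L2 d) : toReal d (toComplex d f) = f := by
  refine Lp.ext ?_
  filter_upwards [coeFn_toReal (toComplex d f), coeFn_toComplex f] with x h1 h2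
  rw [h1, h2, Complex.ofReal_re]

theorem toReal_smul_phiLp (k : Fin d → ℤ) (c : ℂ) : toReal d (c • phiLp k) = mode k c := by
  refine Lp.ext ?_
  filter_upwards [coeFn_toReal (c • phiLp k), Lp.coeFn_smul c (phiLp k), coeFn_phiLp k,
    coeFn_mode k c] with x h1 h2 h3 h4
  rw [h1, h2, h4, Pi.smul_apply, h3, smul_eq_mul]

theorem phiBasis_repr_toComplex (f : L2 d) (k : Fin d → ℤ) :
    (phiBasis d).repr (toComplex d f) k = coef f k := by
  rw [phiBasis_repr, coef]
  refine integral_congr_ae ?_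
  filter_upwards [coeFn_toComplex f] with x hx
  rw [hx]

theorem coef_toReal (g : Lp ℂ 2 (volume : Measure (Torus d))) (k : Fin d → ℤ) :
    coef (toReal d g) k
      = ((phiBasis d).repr g k + conj ((phiBasis d).repr g (-k))) / 2 := by
  rw [phiBasis_repr, phiBasis_repr, coef, ← integral_conj, ← integral_add, ← integral_div]
  · refine integral_congr_ae ?_
    filter_upwards [coeFn_toReal g] with x hx
    rw [hx, phi_neg, Complex.re_eq_add_conj]
    simp only [map_mul, RingHomCompTriple.comp_apply, RingHom.id_apply]
    ring
  · exact integrable_mul_conj_phi g k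
  · exact (Complex.conjLIE.toContinuousLinearEquiv.toContinuousLinearMap).integrable_comp
      (integrable_mul_conj_phi g (-k))

theorem coef_neg_index (f : L2 d) (k : Fin d → ℤ) : coef f (-k) = conj (coef f k) := by
  rw [coef, coef, ← integral_conj]
  refine integral_congr_ae (Eventually.of_forall fun x => ?_)
  simp [phi_neg]

theorem coef_sub (f g : L2 d) (k : Fin d → ℤ) : coef (f - g) k = coef f k - coef g k := by
  rw [eq_sub_iff_add_eq, ← coef_add, sub_add_cancel]

theorem hasSum_coef_sq (f : L2 d) : HasSum (fun k => ‖coef f k‖ ^ 2) (‖f‖ ^ 2) := by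
  have h := lp.hasSum_norm (p := 2) (by norm_num) ((phiBasis d).repr (toComplex d f))
  simpa [phiBasis_repr_toComplex, norm_toComplex] using h

theorem L2_ext {f g : L2 d} (h : ∀ k, coef f k = coef g k) : f = g := by
  have hsum := hasSum_coef_sq (f - g)
  simp only [coef_sub, h, sub_self, norm_zero, ne_eq, OfNat.ofNat_ne_zero, not_false_eq_true,
    zero_pow] at hsum
  simpa [sub_eq_zero] using hsum.unique hasSum_zero

theorem exists_coef_eq {c : (Fin d → ℤ) → ℂ} (hc : ∀ k, c (-k) = conj (c k))
    (hs : Summable fun k => ‖c k‖ ^ 2) : ∃ f : L2 d, ∀ k, coef f k = c k := by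
  have hmem : Memℓp c 2 := memℓp_gen (by simpa using hs)
  refine ⟨toReal d ((phiBasis d).repr.symm ⟨c, hmem⟩), fun k => ?_⟩
  rw [coef_toReal, LinearIsometryEquiv.apply_symm_apply]
  simp [hc]

theorem hasSum_mode_coef (f : L2 d) : HasSum (fun k => mode k (coef f k)) f := by
  have h := ((phiBasis d).hasSum_repr (toComplex d f)).mapL (toReal d)
  simpa only [phiBasis_repr_toComplex, phiBasis_apply, toReal_smul_phiLp, toReal_toComplex] using h

theorem mode_ofReal_mul (k : Fin d → ℤ) (r : ℝ) (c : ℂ) : mode k (r * c) = r • mode k c := by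
  rw [mode, mode, ← map_smul]
  congr 1
  ext x
  simp [modeFun, mul_assoc]

end FourierBasis

section Weights

variable {d : ℕ}

/-- The weight `⟨k⟩ = (1 + |k|²)^{1/2}` of the `H¹` norm. -/
def bracket (k : Fin d → ℤ) : ℝ := Real.sqrt (1 + freq k ^ 2)

theorem freq_nonneg (k : Fin d → ℤ) : 0 ≤ freq k := Real.sqrt_nonneg _

theorem freq_neg (k : Fin d → ℤ) : freq (-k) = freq k := by simp [freq]

theorem freq_eq_zero {k : Fin d → ℤ} : freq k = 0 ↔ k = 0 := by
  rw [freq, Real.sqrt_eq_zero (by positivity),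
    Finset.sum_eq_zero_iff_of_nonneg (by intros; positivity)]
  simp [funext_iff]

theorem bracket_neg (k : Fin d → ℤ) : bracket (-k) = bracket k := by simp [bracket, freq_neg]

theorem bracket_sq (k : Fin d → ℤ) : bracket k ^ 2 = 1 + freq k ^ 2 :=
  Real.sq_sqrt (by positivity)

theorem one_le_bracket (k : Fin d → ℤ) : 1 ≤ bracket k :=
  Real.one_le_sqrt.2 (by nlinarith [sq_nonneg (freq k)])

theorem bracket_pos (k : Fin d → ℤ) : 0 < bracket k := one_pos.trans_le (one_le_bracket k)

theorem freq_le_bracket (k : Fin d → ℤ) : freq k ≤ bracket k :=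
  Real.le_sqrt_of_sq_le (by linarith)

theorem bracket_le (k : Fin d → ℤ) : bracket k ≤ 1 + freq k :=
  Real.sqrt_le_iff.2 ⟨by linarith [freq_nonneg k], by nlinarith [freq_nonneg k]⟩

end Weights

/-! ### Fourier multipliers -/

/-- A space of real functions on the torus described by a weight on the Fourier side: it consists of
the `f ∈ L²` for which `∑ (weight k)² |⟨f, φ_k⟩|²` is finite, this sum being the square of the
norm. It allows one to treat `L²` (weight `1`) and `H¹` (weight `⟨k⟩`) at once. -/
class FourierSpace (d : outParam ℕ) (E : Type*) [NormedAddCommGroup E] [NormedSpace ℝ E] where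
  /-- The inclusion into `L²`. -/
  toL2 : E →ₗ[ℝ] L2 d
  /-- The weight on the Fourier side. -/
  weight (E) : (Fin d → ℤ) → ℝ
  one_le_weight (E) : ∀ k, 1 ≤ weight k
  hasSum_sq : ∀ x, HasSum (fun k => (weight k * ‖coef (toL2 x) k‖) ^ 2) (‖x‖ ^ 2)
  exists_toL2_eq : ∀ f, Summable (fun k => (weight k * ‖coef f k‖) ^ 2) → ∃ x, toL2 x = f

instance L2.fourierSpace (d : ℕ) : FourierSpace d (L2 d) where
  toL2 := LinearMap.id
  weight _ := 1
  one_le_weight _ := le_rfl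
  hasSum_sq f := by simpa using hasSum_coef_sq f
  exists_toL2_eq f _ := ⟨f, rfl⟩

instance H1.fourierSpace (d : ℕ) : FourierSpace d (H1 d) where
  toL2 := H1.toL2
  weight := bracket
  one_le_weight := one_le_bracket
  hasSum_sq u := by
    have hfreq : Summable fun k => freq k ^ 2 * ‖coef u.toL2 k‖ ^ 2 := u.2
    rw [H1.norm_sq_eq]
    refine ((hasSum_coef_sq u.toL2).add hfreq.hasSum).congr_fun fun k => ?_
    rw [mul_pow, bracket_sq, add_mul, one_mul]
  exists_toL2_eq f hf := by
    refine ⟨⟨f, Summable.of_nonneg_of_le (fun k => by positivity) (fun k => ?_) hf⟩, rfl⟩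
    rw [← mul_pow]
    gcongr
    · exact mul_nonneg (freq_nonneg k) (norm_nonneg _)
    · exact freq_le_bracket k

section Multiplier

variable {d : ℕ} {E E' : Type*} [NormedAddCommGroup E] [NormedSpace ℝ E] [FourierSpace d E]
  [NormedAddCommGroup E'] [NormedSpace ℝ E'] [FourierSpace d E']

namespace FourierSpace

theorem weight_nonneg (E : Type*) [NormedAddCommGroup E] [NormedSpace ℝ E] [FourierSpace d E]
    (k : Fin d → ℤ) : 0 ≤ weight E k :=
  zero_le_one.trans (one_le_weight E k)

theorem ext_coef {x y : E} (h : ∀ k, coef (toL2 x) k = coef (toL2 y) k) : x = y := by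
  have hsum := hasSum_sq (x - y)
  simp only [map_sub, L2_ext h, sub_self, coef_zero, norm_zero, mul_zero, ne_eq,
    OfNat.ofNat_ne_zero, not_false_eq_true, zero_pow] at hsum
  simpa [sub_eq_zero] using hsum.unique hasSum_zero

theorem exists_coef_toL2_eq {c : (Fin d → ℤ) → ℂ} (hc : ∀ k, c (-k) = conj (c k))
    (hs : Summable fun k => (weight E k * ‖c k‖) ^ 2) :
    ∃ x : E, ∀ k, coef (toL2 x) k = c k := by
  obtain ⟨f, hf⟩ := exists_coef_eq hc (hs.of_nonneg_of_le (fun k => by positivity) fun k =>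
    pow_le_pow_left₀ (norm_nonneg _)
      (le_mul_of_one_le_left (norm_nonneg _) (one_le_weight E k)) 2)
  obtain ⟨x, rfl⟩ := exists_toL2_eq (E := E) f (by simpa only [hf] using hs)
  exact ⟨x, hf⟩

theorem norm_le_of_coef_le {x : E} {y : E'} {M : ℝ} (hM : 0 ≤ M)
    (h : ∀ k, weight E' k * ‖coef (toL2 y) k‖ ≤ M * (weight E k * ‖coef (toL2 x) k‖)) :
    ‖y‖ ≤ M * ‖x‖ := by
  refine abs_le_of_sq_le_sq' ?_ (by positivity) |>.2
  rw [mul_pow]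
  refine hasSum_le (fun k => ?_) (hasSum_sq y) ((hasSum_sq x).mul_left (M ^ 2))
  rw [← mul_pow]
  exact pow_le_pow_left₀ (mul_nonneg (weight_nonneg E' k) (norm_nonneg _)) (h k) 2

theorem norm_le_of_coef_eq_mul {x : E} {y : E'} {m : (Fin d → ℤ) → ℝ} {M : ℝ} (hM : 0 ≤ M)
    (h : ∀ k, coef (toL2 y) k = m k * coef (toL2 x) k)
    (hm : ∀ k, weight E' k * |m k| ≤ M * weight E k) : ‖y‖ ≤ M * ‖x‖ :=
  norm_le_of_coef_le hM fun k => by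
    rw [h, norm_mul, Complex.norm_real, Real.norm_eq_abs, ← mul_assoc, ← mul_assoc]
    exact mul_le_mul_of_nonneg_right (hm k) (norm_nonneg _)

end FourierSpace

open FourierSpace

variable (E E') in
/-- The even symbols `m` for which the Fourier multiplier `m` maps `E` boundedly to `E'`. -/
structure IsMultiplierSymbol (m : (Fin d → ℤ) → ℝ) : Prop where
  even : ∀ k, m (-k) = m k
  bounded : ∃ M, ∀ k, weight E' k * |m k| ≤ M * weight E k

theorem IsMultiplierSymbol.exists_nonneg_bound {m : (Fin d → ℤ) → ℝ}
    (hm : IsMultiplierSymbol E E' m) :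
    ∃ M, 0 ≤ M ∧ ∀ k, weight E' k * |m k| ≤ M * weight E k := by
  obtain ⟨M, hM⟩ := hm.bounded
  have hpos : 0 < weight E (0 : Fin d → ℤ) := one_pos.trans_le (one_le_weight E 0)
  exact ⟨M, nonneg_of_mul_nonneg_left
    ((mul_nonneg (weight_nonneg E' 0) (abs_nonneg _)).trans (hM 0)) hpos, hM⟩

theorem IsMultiplierSymbol.exists_coef_eq {m : (Fin d → ℤ) → ℝ}
    (hm : IsMultiplierSymbol E E' m) (x : E) :
    ∃ y : E', ∀ k, coef (toL2 y) k = m k * coef (toL2 x) k := by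
  obtain ⟨M, hM⟩ := hm.bounded
  refine exists_coef_toL2_eq (fun k => ?_)
    (((hasSum_sq x).summable.mul_left (M ^ 2)).of_nonneg_of_le (fun k => by positivity) fun k => ?_)
  · rw [hm.even, coef_neg_index, map_mul, Complex.conj_ofReal]
  · rw [← mul_pow, norm_mul, Complex.norm_real, Real.norm_eq_abs, ← mul_assoc, ← mul_assoc]
    exact pow_le_pow_left₀
      (mul_nonneg (mul_nonneg (weight_nonneg E' k) (abs_nonneg _)) (norm_nonneg _))
      (mul_le_mul_of_nonneg_right (hM k) (norm_nonneg _)) 2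

/-- The Fourier multiplier `∑ c_k φ_k ↦ ∑ m_k c_k φ_k` from `E` to `E'`. -/
def multiplier {m : (Fin d → ℤ) → ℝ} (hm : IsMultiplierSymbol E E' m) : E →L[ℝ] E' :=
  LinearMap.mkContinuousOfExistsBound
    { toFun x := (hm.exists_coef_eq x).choose
      map_add' x y := ext_coef fun k => by
        rw [(hm.exists_coef_eq (x + y)).choose_spec, map_add, map_add, coef_add, coef_add,
          (hm.exists_coef_eq x).choose_spec, (hm.exists_coef_eq y).choose_spec, mul_add]
      map_smul' a x := ext_coef fun k => by
        rw [(hm.exists_coef_eq (a • x)).choose_spec, RingHom.id_apply, map_smul, map_smul,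
          coef_smul, coef_smul, (hm.exists_coef_eq x).choose_spec, mul_left_comm] }
    (hm.exists_nonneg_bound.imp fun _ hM x =>
      norm_le_of_coef_eq_mul hM.1 (hm.exists_coef_eq x).choose_spec hM.2)

theorem coef_toL2_multiplier {m : (Fin d → ℤ) → ℝ} (hm : IsMultiplierSymbol E E' m) (x : E)
    (k : Fin d → ℤ) : coef (toL2 (multiplier hm x)) k = m k * coef (toL2 x) k :=
  (hm.exists_coef_eq x).choose_spec k

theorem tendsto_zero_of_coef_eq_mul {ι : Type*} {l : Filter ι} {x : E} {y : ι → E'}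
    {m : ι → (Fin d → ℤ) → ℝ} {M : ℝ}
    (h : ∀ᶠ t in l, ∀ k, coef (toL2 (y t)) k = m t k * coef (toL2 x) k)
    (hm : ∀ᶠ t in l, ∀ k, weight E' k * |m t k| ≤ M * weight E k)
    (h0 : ∀ k, Tendsto (fun t => m t k) l (𝓝 0)) : Tendsto y l (𝓝 0) := by
  have hterm : ∀ᶠ t in l, ∀ k, (weight E' k * ‖coef (toL2 (y t)) k‖) ^ 2
      = (weight E' k * |m t k| * ‖coef (toL2 x) k‖) ^ 2 := by
    filter_upwards [h] with t ht k
    rw [ht, norm_mul, Complex.norm_real, Real.norm_eq_abs, mul_assoc]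
  have hsum : Tendsto (fun t => ∑' k, (weight E' k * |m t k| * ‖coef (toL2 x) k‖) ^ 2) l
      (𝓝 (∑' _ : Fin d → ℤ, (0 : ℝ))) := by
    refine tendsto_tsum_of_dominated_convergence ((hasSum_sq x).summable.mul_left (M ^ 2))
      (fun k => ?_) ?_
    · simpa using ((((h0 k).abs.const_mul (weight E' k)).mul_const ‖coef (toL2 x) k‖).pow 2)
    · filter_upwards [hm] with t ht k
      rw [Real.norm_of_nonneg (by positivity), ← mul_pow, ← mul_assoc]
      exact pow_le_pow_left₀
        (mul_nonneg (mul_nonneg (weight_nonneg E' k) (abs_nonneg _)) (norm_nonneg _))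
        (mul_le_mul_of_nonneg_right (ht k) (norm_nonneg _)) 2
  rw [tsum_zero] at hsum
  have hsq : Tendsto (fun t => ‖y t‖ ^ 2) l (𝓝 0) := by
    refine hsum.congr' (hterm.mono fun t ht => ?_)
    rw [← tsum_congr ht, (hasSum_sq (y t)).tsum_eq]
  simpa [tendsto_zero_iff_norm_tendsto_zero] using hsq.sqrt

theorem tendsto_of_coef_eq_mul {ι : Type*} {l : Filter ι} [l.NeBot] {x : E} {y : ι → E'} {z : E'}
    {m : ι → (Fin d → ℤ) → ℝ} {n : (Fin d → ℤ) → ℝ} {M : ℝ}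
    (h : ∀ t k, coef (toL2 (y t)) k = m t k * coef (toL2 x) k)
    (hz : ∀ k, coef (toL2 z) k = n k * coef (toL2 x) k)
    (hm : ∀ᶠ t in l, ∀ k, weight E' k * |m t k| ≤ M * weight E k)
    (hmn : ∀ k, Tendsto (fun t => m t k) l (𝓝 (n k))) : Tendsto y l (𝓝 z) := by
  have hn : ∀ k, weight E' k * |n k| ≤ M * weight E k := fun k =>
    le_of_tendsto ((hmn k).abs.const_mul _) (hm.mono fun t ht => ht k)
  rw [← tendsto_sub_nhds_zero_iff]
  refine tendsto_zero_of_coef_eq_mul (x := x) (m := fun t k => m t k - n k) (M := M + M)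
    (Eventually.of_forall fun t k => ?_) (hm.mono fun t ht k => ?_)
    fun k => tendsto_sub_nhds_zero_iff.2 (hmn k)
  · rw [map_sub, coef_sub, h, hz]
    push_cast
    ring
  · calc weight E' k * |m t k - n k| ≤ weight E' k * (|m t k| + |n k|) :=
          mul_le_mul_of_nonneg_left (abs_sub _ _) (weight_nonneg E' k)
      _ ≤ (M + M) * weight E k := by linarith [ht k, hn k]

theorem continuous_of_coef_eq_mul {x : E} {y : ℝ → E'} {m : ℝ → (Fin d → ℤ) → ℝ} {M : ℝ → ℝ}
    (h : ∀ t k, coef (toL2 (y t)) k = m t k * coef (toL2 x) k)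
    (hm : ∀ t k, weight E' k * |m t k| ≤ M t * weight E k) (hM : Continuous M)
    (hmc : ∀ k, Continuous fun t => m t k) : Continuous y := by
  refine continuous_iff_continuousAt.2 fun t₀ =>
    tendsto_of_coef_eq_mul (M := M t₀ + 1) h (h t₀) ?_ fun k => (hmc k).tendsto t₀
  filter_upwards [(hM.tendsto t₀).eventually (gt_mem_nhds (lt_add_one _))] with t ht k
  exact (hm t k).trans (mul_le_mul_of_nonneg_right ht.le (weight_nonneg E k))

end Multiplier

section SobolevSpace

variable {d : ℕ}

theorem H1_ext {u v : H1 d} (h : ∀ k, coef u.toL2 k = coef v.toL2 k) : u = v :=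
  FourierSpace.ext_coef h

theorem isMultiplierSymbol_inv_bracket :
    IsMultiplierSymbol (L2 d) (H1 d) fun k => (bracket k)⁻¹ where
  even k := by rw [bracket_neg]
  bounded := ⟨1, fun k => by
    change bracket k * |(bracket k)⁻¹| ≤ 1 * 1
    rw [abs_of_pos (inv_pos.2 (bracket_pos k)), mul_inv_cancel₀ (bracket_pos k).ne', one_mul]⟩

theorem isMultiplierSymbol_bracket : IsMultiplierSymbol (H1 d) (L2 d) bracket where
  even := bracket_neg
  bounded := ⟨1, fun k => by
    change 1 * |bracket k| ≤ 1 * bracket k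
    rw [abs_of_pos (bracket_pos k)]⟩

theorem multiplier_inv_bracket_mode (k : Fin d → ℤ) (c : ℂ) :
    multiplier isMultiplierSymbol_inv_bracket (mode k c) = H1.mode k ((bracket k)⁻¹ * c) := by
  refine FourierSpace.ext_coef fun j => ?_
  rw [coef_toL2_multiplier]
  change _ * coef (mode k c) j = coef (mode k ((bracket k)⁻¹ * c)) j
  by_cases hj : j = k ∨ j = -k
  · have hbracket : bracket j = bracket k := by
      rcases hj with rfl | rfl
      · rfl
      · exact bracket_neg k
    rw [mode_ofReal_mul, coef_smul, hbracket]
  · rw [not_or] at hj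
    rw [coef_mode_eq_zero k j c hj.1 hj.2, coef_mode_eq_zero k j _ hj.1 hj.2, mul_zero]

/-- The isomorphism `(1 - Δ)^{-1/2} : L² → H¹` transports the expansion from `L²`. -/
theorem H1.hasSum_mode_coef (u : H1 d) : HasSum (fun k => H1.mode k (coef u.toL2 k)) u := by
  set f : L2 d := multiplier isMultiplierSymbol_bracket u
  have hf : ∀ k, coef f k = bracket k * coef u.toL2 k :=
    coef_toL2_multiplier isMultiplierSymbol_bracket u
  have hcancel : ∀ (k : Fin d → ℤ) (c : ℂ), ((bracket k)⁻¹ : ℝ) * (bracket k * c) = c := by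
    intro k c
    rw [← mul_assoc, ← Complex.ofReal_mul, inv_mul_cancel₀ (bracket_pos k).ne', Complex.ofReal_one,
      one_mul]
  have hu : multiplier isMultiplierSymbol_inv_bracket f = u := FourierSpace.ext_coef fun k => by
    rw [coef_toL2_multiplier]
    change _ * coef f k = coef u.toL2 k
    rw [hf, hcancel]
  have hsum := (BilinearWave.hasSum_mode_coef f).mapL
    (multiplier isMultiplierSymbol_inv_bracket)
  simpa only [multiplier_inv_bracket_mode, hu, hf, hcancel] using hsum

variable (d) in
/-- The inclusion `H¹ ⊆ L²` as a bounded operator. -/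
def H1.toL2CLM : H1 d →L[ℝ] L2 d :=
  LinearMap.mkContinuous H1.toL2 1 fun u =>
    FourierSpace.norm_le_of_coef_eq_mul (m := fun _ => 1) zero_le_one
      (fun k => by rw [Complex.ofReal_one, one_mul]; rfl)
      fun k => by simpa using! one_le_bracket k

end SobolevSpace

/-! ### The free wave group -/

section WaveGroup

variable {d : ℕ}

open FourierSpace

theorem freq_mul_sinDiv (k : Fin d → ℤ) (t : ℝ) : freq k * sinDiv k t = Real.sin (freq k * t) := by
  rw [sinDiv]
  split_ifs with h
  · rw [freq_eq_zero.2 h, zero_mul, Real.sin_zero]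
  · rw [mul_div_cancel₀ _ (mt freq_eq_zero.1 h)]

theorem sinDiv_neg_index (k : Fin d → ℤ) (t : ℝ) : sinDiv (-k) t = sinDiv k t := by
  simp only [sinDiv, neg_eq_zero, freq_neg]

theorem sinDiv_zero (k : Fin d → ℤ) : sinDiv k 0 = 0 := by
  simp [sinDiv]

theorem continuous_sinDiv (k : Fin d → ℤ) : Continuous (sinDiv k) := by
  unfold sinDiv
  split_ifs
  · exact continuous_id
  · fun_prop

theorem sinDiv_add (k : Fin d → ℤ) (s t : ℝ) :
    sinDiv k (s + t) = Real.cos (freq k * s) * sinDiv k t + sinDiv k s * Real.cos (freq k * t) := by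
  simp only [sinDiv]
  split_ifs with h
  · simp [freq_eq_zero.2 h, add_comm]
  · rw [mul_add, Real.sin_add]
    ring

theorem abs_sinDiv_le (k : Fin d → ℤ) (t : ℝ) : |sinDiv k t| ≤ |t| := by
  rw [sinDiv]
  split_ifs with h
  · exact le_rfl
  · have hf : 0 < freq k := (freq_nonneg k).lt_of_ne' (mt freq_eq_zero.1 h)
    rw [abs_div, abs_of_pos hf, div_le_iff₀ hf, mul_comm, ← abs_of_pos hf, ← abs_mul,
      abs_of_pos hf]
    exact Real.abs_sin_le_abs

theorem bracket_mul_abs_sinDiv_le (k : Fin d → ℤ) (t : ℝ) : bracket k * |sinDiv k t| ≤ 1 + |t| :=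
  calc bracket k * |sinDiv k t| ≤ (1 + freq k) * |sinDiv k t| := by gcongr; exact bracket_le k
    _ = |Real.sin (freq k * t)| + |sinDiv k t| := by
        rw [add_mul, one_mul, add_comm, ← freq_mul_sinDiv, abs_mul, abs_of_nonneg (freq_nonneg k)]
    _ ≤ 1 + |t| := add_le_add (Real.abs_sin_le_one _) (abs_sinDiv_le k t)

theorem abs_freq_mul_sin_le (k : Fin d → ℤ) (t : ℝ) :
    |-(freq k * Real.sin (freq k * t))| ≤ bracket k := by
  rw [abs_neg, abs_mul, abs_of_nonneg (freq_nonneg k)]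
  exact (mul_le_of_le_one_right (freq_nonneg k) (Real.abs_sin_le_one _)).trans (freq_le_bracket k)

theorem tendsto_inv_mul_sinDiv (k : Fin d → ℤ) :
    Tendsto (fun t => t⁻¹ * sinDiv k t) (𝓝[≠] 0) (𝓝 1) := by
  have hderiv : HasDerivAt (sinDiv k) 1 0 := by
    unfold sinDiv
    split_ifs with h
    · exact hasDerivAt_id 0
    · simpa [mt freq_eq_zero.1 h] using
        (((hasDerivAt_id (0 : ℝ)).const_mul (freq k)).sin).div_const (freq k)
  simpa [sinDiv_zero] using hderiv.tendsto_slope_zero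

theorem isMultiplierSymbol_cos (E : Type*) [NormedAddCommGroup E] [NormedSpace ℝ E]
    [FourierSpace d E] (t : ℝ) : IsMultiplierSymbol E E fun k => Real.cos (freq k * t) where
  even k := by rw [freq_neg]
  bounded := ⟨1, fun k => by
    rw [mul_comm]
    exact mul_le_mul_of_nonneg_right (Real.abs_cos_le_one _) (weight_nonneg E k)⟩

theorem isMultiplierSymbol_sinDiv (t : ℝ) :
    IsMultiplierSymbol (L2 d) (H1 d) fun k => sinDiv k t where
  even k := sinDiv_neg_index k t
  bounded := ⟨1 + |t|, fun k => (bracket_mul_abs_sinDiv_le k t).trans_eq (mul_one _).symm⟩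

theorem isMultiplierSymbol_neg_freq_mul_sin (t : ℝ) :
    IsMultiplierSymbol (H1 d) (L2 d) fun k => -(freq k * Real.sin (freq k * t)) where
  even k := by rw [freq_neg]
  bounded := ⟨1, fun k => mul_le_mul_of_nonneg_left (abs_freq_mul_sin_le k t) zero_le_one⟩

/-- `cos(t√(-Δ))` on `L²` or `H¹`. -/
def cosOp (E : Type*) [NormedAddCommGroup E] [NormedSpace ℝ E] [FourierSpace d E] (t : ℝ) :
    E →L[ℝ] E :=
  multiplier (isMultiplierSymbol_cos E t)

variable (d) in
/-- `sin(t√(-Δ)) / √(-Δ)` from `L²` to `H¹`. -/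
def sinOp (t : ℝ) : L2 d →L[ℝ] H1 d := multiplier (isMultiplierSymbol_sinDiv t)

variable (d) in
/-- The derivative `-√(-Δ) sin(t√(-Δ))` of `cos(t√(-Δ))`, from `H¹` to `L²`. -/
def cosDerivOp (t : ℝ) : H1 d →L[ℝ] L2 d := multiplier (isMultiplierSymbol_neg_freq_mul_sin t)

theorem coef_cosOp_L2 (t : ℝ) (v : L2 d) (k : Fin d → ℤ) :
    coef (cosOp (L2 d) t v) k = (Real.cos (freq k * t) : ℝ) * coef v k :=
  coef_toL2_multiplier (isMultiplierSymbol_cos (L2 d) t) v k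

theorem coef_cosOp_H1 (t : ℝ) (w : H1 d) (k : Fin d → ℤ) :
    coef (cosOp (H1 d) t w).toL2 k = (Real.cos (freq k * t) : ℝ) * coef w.toL2 k :=
  coef_toL2_multiplier (isMultiplierSymbol_cos (H1 d) t) w k

theorem coef_sinOp (t : ℝ) (v : L2 d) (k : Fin d → ℤ) :
    coef (sinOp d t v).toL2 k = (sinDiv k t : ℝ) * coef v k :=
  coef_toL2_multiplier (isMultiplierSymbol_sinDiv t) v k

theorem coef_cosDerivOp (t : ℝ) (w : H1 d) (k : Fin d → ℤ) :
    coef (cosDerivOp d t w) k = (-(freq k * Real.sin (freq k * t)) : ℝ) * coef w.toL2 k :=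
  coef_toL2_multiplier (isMultiplierSymbol_neg_freq_mul_sin t) w k

variable (d) in
/-- The free evolution `e^{t𝒜}` as a bounded operator. -/
def waveGroup (t : ℝ) : State d →L[ℝ] State d :=
  ((cosOp (H1 d) t).coprod (sinOp d t)).prod ((cosDerivOp d t).coprod (cosOp (L2 d) t))

theorem waveGroup_apply (t : ℝ) (W : State d) :
    waveGroup d t W
      = (cosOp (H1 d) t W.1 + sinOp d t W.2, cosDerivOp d t W.1 + cosOp (L2 d) t W.2) := rfl

theorem freeEvolution_eq_waveGroup (t : ℝ) (W : State d) :
    freeEvolution t W = waveGroup d t W := by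
  rw [waveGroup_apply, freeEvolution]
  refine Prod.ext ?_ ?_
  · refine ((H1.hasSum_mode_coef _).congr_fun fun k => ?_).tsum_eq
    rw [map_add, coef_add, coef_cosOp_H1, coef_sinOp, mul_comm _ (coef W.2 k),
      mul_comm _ (coef W.1.toL2 k)]
  · refine ((hasSum_mode_coef _).congr_fun fun k => ?_).tsum_eq
    rw [coef_add, coef_cosDerivOp, coef_cosOp_L2]
    push_cast
    congr 1
    ring

theorem waveGroup_zero : waveGroup d 0 = 1 := by
  refine ContinuousLinearMap.ext fun W => ?_
  rw [waveGroup_apply]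
  refine Prod.ext (H1_ext fun k => ?_) (L2_ext fun k => ?_)
  · simp [coef_add, coef_cosOp_H1, coef_sinOp, sinDiv_zero]
  · simp [coef_add, coef_cosDerivOp, coef_cosOp_L2]

theorem waveGroup_add (s t : ℝ) (W : State d) :
    waveGroup d (s + t) W = waveGroup d s (waveGroup d t W) := by
  simp only [waveGroup_apply]
  refine Prod.ext (H1_ext fun k => ?_) (L2_ext fun k => ?_)
  · simp only [map_add, coef_add, coef_cosOp_H1, coef_sinOp, coef_cosDerivOp, coef_cosOp_L2,
      sinDiv_add, mul_add, Real.cos_add, ← freq_mul_sinDiv]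
    push_cast
    ring
  · simp only [map_add, coef_add, coef_cosOp_H1, coef_sinOp, coef_cosDerivOp, coef_cosOp_L2,
      mul_add, Real.cos_add, Real.sin_add, ← freq_mul_sinDiv]
    push_cast
    ring

theorem continuous_cosOp_apply {E : Type*} [NormedAddCommGroup E] [NormedSpace ℝ E]
    [FourierSpace d E] (x : E) : Continuous fun t => cosOp E t x :=
  continuous_of_coef_eq_mul (M := fun _ => 1)
    (fun t => coef_toL2_multiplier (isMultiplierSymbol_cos E t) x)
    (fun t k => by
      rw [mul_comm]
      exact mul_le_mul_of_nonneg_right (Real.abs_cos_le_one _) (weight_nonneg E k))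
    continuous_const fun k => by fun_prop

theorem continuous_sinOp_apply (v : L2 d) : Continuous fun t => sinOp d t v :=
  continuous_of_coef_eq_mul (M := fun t => 1 + |t|)
    (fun t => coef_toL2_multiplier (isMultiplierSymbol_sinDiv t) v)
    (fun t k => (bracket_mul_abs_sinDiv_le k t).trans_eq (mul_one _).symm)
    (by fun_prop) continuous_sinDiv

theorem continuous_cosDerivOp_apply (w : H1 d) : Continuous fun t => cosDerivOp d t w :=
  continuous_of_coef_eq_mul (M := fun _ => 1)
    (fun t => coef_toL2_multiplier (isMultiplierSymbol_neg_freq_mul_sin t) w)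
    (fun t k => mul_le_mul_of_nonneg_left (abs_freq_mul_sin_le k t) zero_le_one)
    continuous_const fun k => by fun_prop

theorem isOperatorGroup_waveGroup : IsOperatorGroup (waveGroup d) where
  zero := waveGroup_zero
  add := waveGroup_add
  continuous_apply W := ((continuous_cosOp_apply W.1).add (continuous_sinOp_apply W.2)).prodMk
    ((continuous_cosDerivOp_apply W.1).add (continuous_cosOp_apply W.2))

theorem toL2_cosOp (t : ℝ) (w : H1 d) : (cosOp (H1 d) t w).toL2 = cosOp (L2 d) t w.toL2 :=
  L2_ext fun k => by rw [coef_cosOp_H1, coef_cosOp_L2]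

theorem norm_le_of_coef_eq_sinDiv_mul {E : Type*} [NormedAddCommGroup E] [NormedSpace ℝ E]
    [FourierSpace d E] {t : ℝ} {x y : E}
    (h : ∀ k, coef (toL2 y) k = (sinDiv k t : ℝ) * coef (toL2 x) k) : ‖y‖ ≤ |t| * ‖x‖ :=
  norm_le_of_coef_eq_mul (abs_nonneg t) h fun k => by
    rw [mul_comm]
    exact mul_le_mul_of_nonneg_right (abs_sinDiv_le k t) (weight_nonneg E k)

theorem norm_sinOp_toL2_le (t : ℝ) (g : H1 d) : ‖sinOp d t g.toL2‖ ≤ |t| * ‖g‖ :=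
  norm_le_of_coef_eq_sinDiv_mul (coef_sinOp t g.toL2)

theorem norm_toL2_sinOp_le (t : ℝ) (v : L2 d) : ‖(sinOp d t v).toL2‖ ≤ |t| * ‖v‖ :=
  norm_le_of_coef_eq_sinDiv_mul (coef_sinOp t v)

theorem norm_cosOp_toL2_sub_le (t : ℝ) (g : H1 d) :
    ‖cosOp (L2 d) t g.toL2 - g.toL2‖ ≤ |t| * ‖g‖ := by
  refine norm_le_of_coef_eq_mul (x := g) (m := fun k => Real.cos (freq k * t) - 1)
    (abs_nonneg t) (fun k => ?_) fun k => ?_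
  · change coef (cosOp (L2 d) t g.toL2 - g.toL2) k = _ * coef g.toL2 k
    rw [coef_sub, coef_cosOp_L2]
    push_cast
    ring
  · change 1 * |Real.cos (freq k * t) - 1| ≤ |t| * bracket k
    calc 1 * |Real.cos (freq k * t) - 1| ≤ |freq k * t| := by
          simpa using Real.abs_cos_sub_cos_le (freq k * t) 0
      _ = |t| * freq k := by rw [abs_mul, abs_of_nonneg (freq_nonneg k), mul_comm]
      _ ≤ |t| * bracket k := by gcongr; exact freq_le_bracket k

theorem tendsto_inv_smul_of_coef_eq_sinDiv_mul {E : Type*} [NormedAddCommGroup E]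
    [NormedSpace ℝ E] [FourierSpace d E] {x : E} {y : ℝ → E}
    (h : ∀ t k, coef (toL2 (y t)) k = (sinDiv k t : ℝ) * coef (toL2 x) k) :
    Tendsto (fun t => t⁻¹ • y t) (𝓝[≠] 0) (𝓝 x) := by
  refine tendsto_of_coef_eq_mul (x := x) (m := fun t k => t⁻¹ * sinDiv k t) (n := fun _ => 1)
    (M := 1) (fun t k => ?_) (fun k => by rw [Complex.ofReal_one, one_mul])
    (Eventually.of_forall fun t k => ?_) tendsto_inv_mul_sinDiv
  · rw [map_smul, coef_smul, h, Complex.ofReal_mul, mul_assoc]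
  · rw [mul_comm, abs_mul, abs_inv]
    exact mul_le_mul_of_nonneg_right
      (inv_mul_le_one_of_le₀ (abs_sinDiv_le k t) (abs_nonneg t)) (weight_nonneg E k)

theorem tendsto_inv_smul_sinOp_toL2 (g : H1 d) :
    Tendsto (fun t : ℝ => t⁻¹ • sinOp d t g.toL2) (𝓝[≠] 0) (𝓝 g) :=
  tendsto_inv_smul_of_coef_eq_sinDiv_mul fun t => coef_sinOp t g.toL2

theorem tendsto_inv_smul_toL2_sinOp (v : L2 d) :
    Tendsto (fun t : ℝ => t⁻¹ • (sinOp d t v).toL2) (𝓝[≠] 0) (𝓝 v) :=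
  tendsto_inv_smul_of_coef_eq_sinDiv_mul (y := fun t => (sinOp d t v).toL2) fun t => coef_sinOp t v

end WaveGroup

/-! ### The control operators -/

section Multiplication

variable {d : ℕ}

/-- Multiplication by a continuous function on `L²`. -/
def mulCLM : C(Torus d, ℝ) →L[ℝ] L2 d →L[ℝ] L2 d :=
  ((ContinuousLinearMap.lsmul ℝ ℝ).holderL volume ∞ 2 2).comp (ContinuousMap.toLp ∞ volume ℝ)

theorem coeFn_mulCLM (m : C(Torus d, ℝ)) (f : L2 d) :
    mulCLM m f =ᵐ[volume] fun x => m x * f x := by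
  filter_upwards [(ContinuousLinearMap.lsmul ℝ ℝ).coeFn_holder (r := 2)
      (ContinuousMap.toLp ∞ volume ℝ m) f,
    ContinuousMap.coeFn_toLp (p := ∞) (𝕜 := ℝ) volume m] with x hmul hm
  exact hmul.trans (congrArg (· * f x) hm)

theorem mulCLM_mul (m n : C(Torus d, ℝ)) (f : L2 d) :
    mulCLM (m * n) f = mulCLM m (mulCLM n f) := by
  refine Lp.ext ?_
  filter_upwards [coeFn_mulCLM (m * n) f, coeFn_mulCLM m (mulCLM n f), coeFn_mulCLM n f]
    with x hmn hm hn
  rw [hmn, hm, hn, ContinuousMap.mul_apply, mul_assoc]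

/-- The kick operator `(w, v) ↦ (0, m w)`. -/
def kick : C(Torus d, ℝ) →L[ℝ] State d →L[ℝ] State d :=
  ((ContinuousLinearMap.inr ℝ (H1 d) (L2 d)).postcomp (State d)).comp
    ((((H1.toL2CLM d).comp (ContinuousLinearMap.fst ℝ (H1 d) (L2 d))).precomp (L2 d)).comp mulCLM)

theorem kick_apply (m : C(Torus d, ℝ)) (W : State d) : kick m W = (0, mulCLM m W.1.toL2) := rfl

theorem kick_kick (m n : C(Torus d, ℝ)) (W : State d) : kick m (kick n W) = 0 := by
  rw [kick_apply, kick_apply, map_zero, map_zero, Prod.mk_zero_zero]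

variable (d) in
/-- The operator `∑_j q_j μ_j ℬ` as a function of `q`. -/
def controlCLM : (Fin (2 * d + 1) → ℝ) →L[ℝ] State d →L[ℝ] State d :=
  ∑ j, (ContinuousLinearMap.proj j).smulRight (kick (mu j))

theorem controlCLM_apply (q : Fin (2 * d + 1) → ℝ) :
    controlCLM d q = kick (∑ j, q j • mu j) := by
  simp [controlCLM]

theorem isSolution_iff {τ : ℝ} {p : ℝ → Fin (2 * d + 1) → ℝ} {W₀ : State d} {W : ℝ → State d} :
    IsSolution τ p W₀ W ↔ IsMild (waveGroup d) (fun s => controlCLM d (p s)) τ W₀ W := by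
  have hop : ∀ q V, controlOp q V = controlCLM d q V := fun q V => by
    rw [controlCLM_apply]
    rfl
  constructor
  · rintro ⟨hcont, hduhamel⟩
    exact ⟨hcont, by simpa only [freeEvolution_eq_waveGroup, hop] using hduhamel⟩
  · rintro ⟨hcont, hduhamel⟩
    exact ⟨hcont, by simpa only [freeEvolution_eq_waveGroup, hop] using hduhamel⟩

end Multiplication

section Kickable

variable {d : ℕ}

/-- The functions `f` for which the kick `(w, v) ↦ (w, v + f w)` can be realized approximately in
arbitrarily small time, whatever the initial state. -/
def Kickable (f : C(Torus d, ℝ)) : Prop :=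
  ∀ W, SmallTimeReachable (waveGroup d) (controlCLM d) W (W + kick f W)

theorem Kickable.add {f g : C(Torus d, ℝ)} (hf : Kickable f) (hg : Kickable g) :
    Kickable (f + g) := fun W => by
  have h := (hf W).trans isOperatorGroup_waveGroup (hg _)
  rwa [map_add, kick_kick, add_zero, add_assoc, ← add_apply, ← map_add] at h

theorem kickable_zero : Kickable (0 : C(Torus d, ℝ)) := fun W => by
  simpa using SmallTimeReachable.refl isOperatorGroup_waveGroup W

theorem kickable_potential (q : Fin (2 * d + 1) → ℝ) : Kickable (∑ j, q j • mu j) := fun W => by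
  rw [← controlCLM_apply]
  exact .add_of_sq_eq_zero isOperatorGroup_waveGroup (by rw [controlCLM_apply, kick_kick])

theorem tendsto_inv_smul_comp_sq {E : Type*} [NormedAddCommGroup E] [NormedSpace ℝ E] {y : ℝ → E}
    {C : ℝ} (hy : ∀ t, ‖y t‖ ≤ |t| * C) :
    Tendsto (fun s : ℝ => s⁻¹ • y (s ^ 2)) (𝓝[≠] 0) (𝓝 0) := by
  have hC : Tendsto (fun s : ℝ => |s| * C) (𝓝[≠] 0) (𝓝 0) := by
    have h : Tendsto (fun s : ℝ => |s| * C) (𝓝 0) (𝓝 (|0| * C)) :=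
      Continuous.tendsto (by fun_prop) 0
    simpa using h.mono_left nhdsWithin_le_nhds
  refine squeeze_zero_norm' ?_ hC
  filter_upwards [self_mem_nhdsWithin] with s hs
  rw [norm_smul, norm_inv, Real.norm_eq_abs, inv_mul_le_iff₀ (abs_pos.2 hs), ← mul_assoc,
    ← abs_mul, ← sq]
  exact hy _

theorem tendsto_sq_nhdsNE_zero : Tendsto (fun s : ℝ => s ^ 2) (𝓝[≠] 0) (𝓝[>] 0) := by
  refine tendsto_nhdsWithin_iff.2 ⟨?_, ?_⟩
  · simpa using ((continuous_pow 2).tendsto (0 : ℝ)).mono_left nhdsWithin_le_nhds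
  · filter_upwards [self_mem_nhdsWithin] with s hs using sq_pos_of_ne_zero hs

/-- The free evolution, over a time `s²`, of a state that has received the kick `s⁻¹ g`. -/
def kickedEvolution (W : State d) (g : H1 d) (s : ℝ) : State d :=
  waveGroup d (s ^ 2) (W + (0, s⁻¹ • g.toL2))

theorem tendsto_kickedEvolution_sub (W : State d) (g : H1 d) :
    Tendsto (fun s => kickedEvolution W g s - (0, s⁻¹ • g.toL2)) (𝓝[≠] 0) (𝓝 W) := by
  have hfree : Tendsto (fun s : ℝ => waveGroup d (s ^ 2) W) (𝓝[≠] 0) (𝓝 W) := by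
    simpa [waveGroup_zero, Function.comp_def] using
      ((isOperatorGroup_waveGroup.continuous_apply W).tendsto 0).comp
        (tendsto_sq_nhdsNE_zero.mono_right nhdsWithin_le_nhds)
  have hprofile : Tendsto (fun s : ℝ => s⁻¹ • sinOp d (s ^ 2) g.toL2) (𝓝[≠] 0) (𝓝 0) :=
    tendsto_inv_smul_comp_sq (y := fun t => sinOp d t g.toL2) fun t => norm_sinOp_toL2_le t g
  have hvelocity : Tendsto (fun s : ℝ => s⁻¹ • (cosOp (L2 d) (s ^ 2) g.toL2 - g.toL2))
      (𝓝[≠] 0) (𝓝 0) :=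
    tendsto_inv_smul_comp_sq (y := fun t => cosOp (L2 d) t g.toL2 - g.toL2)
      fun t => norm_cosOp_toL2_sub_le t g
  have h := hfree.add (hprofile.prodMk_nhds hvelocity)
  rw [Prod.mk_zero_zero, add_zero] at h
  refine h.congr fun s => ?_
  rw [kickedEvolution, map_add, waveGroup_apply _ (0, _), add_sub_assoc]
  simp [smul_sub]

theorem tendsto_inv_smul_kickedEvolution_sub (W : State d) (g : H1 d) :
    Tendsto (fun s => s⁻¹ • ((kickedEvolution W g s).1.toL2 - W.1.toL2)) (𝓝[≠] 0)
      (𝓝 g.toL2) := by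
  have hcos : Tendsto (fun s : ℝ => s⁻¹ • (cosOp (L2 d) (s ^ 2) W.1.toL2 - W.1.toL2))
      (𝓝[≠] 0) (𝓝 0) :=
    tendsto_inv_smul_comp_sq (y := fun t => cosOp (L2 d) t W.1.toL2 - W.1.toL2)
      fun t => norm_cosOp_toL2_sub_le t W.1
  have hsin : Tendsto (fun s : ℝ => s⁻¹ • (sinOp d (s ^ 2) W.2).toL2) (𝓝[≠] 0) (𝓝 0) :=
    tendsto_inv_smul_comp_sq (y := fun t => (sinOp d t W.2).toL2)
      fun t => norm_toL2_sinOp_le t W.2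
  have hkick : Tendsto (fun s : ℝ => (s ^ 2)⁻¹ • (sinOp d (s ^ 2) g.toL2).toL2)
      (𝓝[≠] 0) (𝓝 g.toL2) :=
    (tendsto_inv_smul_toL2_sinOp g.toL2).comp
      (tendsto_sq_nhdsNE_zero.mono_right (nhdsWithin_mono 0 fun _ hx => ne_of_gt hx))
  have h := (hcos.add hsin).add hkick
  rw [zero_add, zero_add] at h
  refine h.congr fun s => ?_
  simp only [kickedEvolution, waveGroup_apply, Prod.fst_add, map_add, map_zero,
    map_smul, toL2_cosOp, sq, mul_inv, mul_smul, smul_sub,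
    smul_add, smul_zero]
  abel

theorem tendsto_kick_kickedEvolution {φ : C(Torus d, ℝ)} {W : State d} {g : H1 d}
    (hg : g.toL2 = mulCLM φ W.1.toL2) :
    Tendsto (fun s => kickedEvolution W g s + kick ((-s⁻¹) • φ) (kickedEvolution W g s))
      (𝓝[≠] 0) (𝓝 (W + kick (-(φ * φ)) W)) := by
  have hmul := ((mulCLM φ).continuous.tendsto _).comp (tendsto_inv_smul_kickedEvolution_sub W g)
  have h := (tendsto_kickedEvolution_sub W g).sub
    ((tendsto_const_nhds (x := (0 : H1 d))).prodMk_nhds hmul)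
  have hlim : W + kick (-(φ * φ)) W = W - (0, mulCLM φ g.toL2) := by
    rw [map_neg, neg_apply, kick_apply, mulCLM_mul, ← hg, sub_eq_add_neg]
  rw [hlim]
  refine h.congr fun s => ?_
  rw [map_smul, smul_apply, kick_apply, Function.comp_apply, map_smul, map_sub,
    ← hg]
  exact Prod.ext (by simp) (by simp [sub_eq_add_neg])

/-- In the limit `s → 0`, conjugating the free evolution over a time `s²` by the kick `s⁻¹ φ`
produces the double commutator of `𝒜` with `φ ℬ`, which is the kick `-φ²`. -/
theorem Kickable.neg_sq {φ : C(Torus d, ℝ)} (hφ : ∀ a : ℝ, Kickable (a • φ))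
    (hH1 : ∀ w : H1 d, ∃ g : H1 d, g.toL2 = mulCLM φ w.toL2) : Kickable (-(φ * φ)) := by
  intro W
  obtain ⟨g, hg⟩ := hH1 W.1
  refine .of_tendsto isOperatorGroup_waveGroup
    (tendsto_sq_nhdsNE_zero.mono_right (nhdsWithin_mono 0 Ioi_subset_Ici_self))
    (Eventually.of_forall fun s => hφ s⁻¹ W) ?_ (tendsto_kick_kickedEvolution hg)
  refine Eventually.of_forall fun s => ?_
  have hstate : W + kick (s⁻¹ • φ) W = W + (0, s⁻¹ • g.toL2) := by
    rw [kick_apply, map_smul, smul_apply, ← hg]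
  rw [hstate]
  exact hφ (-s⁻¹) (kickedEvolution W g s)

end Kickable

/-! ### Realizable kicks: all trigonometric polynomials -/

section Trig

variable {d : ℕ}

/-- The real trigonometric monomial `x ↦ Re (c e^{ik·x})`. -/
def trig (k : Fin d → ℤ) (c : ℂ) : C(Torus d, ℝ) where
  toFun x := (c * expo k x).re

theorem trig_apply (k : Fin d → ℤ) (c : ℂ) (x : Torus d) : trig k c x = (c * expo k x).re := rfl

theorem smul_trig (a : ℝ) (k : Fin d → ℤ) (c : ℂ) : a • trig k c = trig k (a * c) := by
  ext x
  simp only [ContinuousMap.smul_apply, trig_apply, smul_eq_mul, mul_assoc, Complex.re_ofReal_mul]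

theorem coef_mulCLM_trig (k : Fin d → ℤ) (c : ℂ) (f : L2 d) (j : Fin d → ℤ) :
    coef (mulCLM (trig k c) f) j = (c * coef f (j - k) + conj c * coef f (j + k)) / 2 := by
  have hint : ∀ m : Fin d → ℤ, Integrable fun x => (f x : ℂ) * conj (phi m x) := fun m =>
    (integrable_mul_conj_phi (toComplex d f) m).congr (by
      filter_upwards [coeFn_toComplex f] with x hx
      rw [hx])
  simp only [coef]
  rw [← integral_const_mul, ← integral_const_mul,
    ← integral_add ((hint _).const_mul _) ((hint _).const_mul _), ← integral_div]
  refine integral_congr_ae ?_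
  filter_upwards [coeFn_mulCLM (trig k c) f] with x hx
  rw [hx, trig_apply, Complex.ofReal_mul, Complex.re_eq_add_conj]
  simp only [phi_apply, sub_eq_add_neg, expo_add, expo_neg, map_mul, Complex.conj_ofReal,
    Complex.conj_conj]
  ring

theorem freq_add_le (k j : Fin d → ℤ) : freq (k + j) ≤ freq k + freq j := by
  have hnorm : ∀ m : Fin d → ℤ,
      freq m = ‖(WithLp.toLp 2 fun i => (m i : ℝ) : EuclideanSpace ℝ (Fin d))‖ := fun m => by
    simp [EuclideanSpace.norm_eq, freq]
  rw [hnorm, hnorm, hnorm]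
  refine (congrArg norm ?_).trans_le (norm_add_le _ _)
  ext i
  simp

theorem bracket_add_le (k j : Fin d → ℤ) : bracket (k + j) ≤ (1 + freq j) * bracket k := by
  have hj := freq_nonneg j
  have hadd : freq (k + j) ^ 2 ≤ (freq k + freq j) ^ 2 :=
    pow_le_pow_left₀ (freq_nonneg _) (freq_add_le k j) 2
  have hmul : freq j * freq k ≤ freq j * (1 + freq k ^ 2) := by
    gcongr
    nlinarith [sq_nonneg (freq k - 1)]
  refine le_of_sq_le_sq ?_ (by positivity [bracket_pos k])
  rw [mul_pow, bracket_sq, bracket_sq]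
  nlinarith [mul_nonneg (sq_nonneg (freq j)) (sq_nonneg (freq k)),
    mul_nonneg hj (sq_nonneg (freq k))]

theorem exists_toL2_eq_mulCLM_trig (k : Fin d → ℤ) (c : ℂ) (w : H1 d) :
    ∃ g : H1 d, g.toL2 = mulCLM (trig k c) w.toL2 := by
  set a : (Fin d → ℤ) → ℝ := fun j => bracket j * ‖coef w.toL2 j‖
  have ha : Summable fun j => a j ^ 2 := (FourierSpace.hasSum_sq w).summable
  have hminus : Summable fun j => a (j - k) ^ 2 := ha.comp_injective (sub_left_injective (b := k))
  have hplus : Summable fun j => a (j + k) ^ 2 := ha.comp_injective (add_left_injective k)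
  refine FourierSpace.exists_toL2_eq _ (Summable.of_nonneg_of_le (fun j => sq_nonneg _)
    (fun j => ?_) ((hminus.add hplus).mul_left (((1 + freq k) * ‖c‖) ^ 2)))
  have hbound : bracket j * ‖coef (mulCLM (trig k c) w.toL2) j‖
      ≤ (1 + freq k) * ‖c‖ * ((a (j - k) + a (j + k)) / 2) := by
    have hm : bracket j ≤ (1 + freq k) * bracket (j - k) := by
      simpa using bracket_add_le (j - k) k
    have hp : bracket j ≤ (1 + freq k) * bracket (j + k) := by
      simpa [freq_neg] using bracket_add_le (j + k) (-k)
    calc bracket j * ‖coef (mulCLM (trig k c) w.toL2) j‖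
        ≤ bracket j * ((‖c‖ * ‖coef w.toL2 (j - k)‖ + ‖c‖ * ‖coef w.toL2 (j + k)‖) / 2) := by
          rw [coef_mulCLM_trig, norm_div, Complex.norm_ofNat]
          gcongr
          · exact (bracket_pos j).le
          · exact (norm_add_le _ _).trans_eq (by rw [norm_mul, norm_mul, RCLike.norm_conj])
      _ = ‖c‖ * (bracket j * ‖coef w.toL2 (j - k)‖ + bracket j * ‖coef w.toL2 (j + k)‖) / 2 := by
          ring
      _ ≤ ‖c‖ * ((1 + freq k) * bracket (j - k) * ‖coef w.toL2 (j - k)‖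
            + (1 + freq k) * bracket (j + k) * ‖coef w.toL2 (j + k)‖) / 2 := by
          gcongr
      _ = (1 + freq k) * ‖c‖ * ((a (j - k) + a (j + k)) / 2) := by ring
  calc (bracket j * ‖coef (mulCLM (trig k c) w.toL2) j‖) ^ 2
      ≤ ((1 + freq k) * ‖c‖ * ((a (j - k) + a (j + k)) / 2)) ^ 2 :=
        pow_le_pow_left₀ (mul_nonneg (bracket_pos j).le (norm_nonneg _)) hbound 2
    _ ≤ ((1 + freq k) * ‖c‖) ^ 2 * (a (j - k) ^ 2 + a (j + k) ^ 2) := by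
        rw [mul_pow]
        gcongr
        nlinarith [sq_nonneg (a (j - k) - a (j + k)), sq_nonneg (a (j - k) + a (j + k))]

theorem mu_zero : mu (d := d) 0 = 1 := by simp [mu]

theorem exists_mu_eq_cosFun (i : Fin d) : ∃ j, mu j = cosFun i := by
  refine ⟨⟨2 * i + 1, by omega⟩, ?_⟩
  rw [mu, dif_neg (by simp [Fin.ext_iff]), if_pos (by simp)]
  congr 1
  ext
  simp

theorem exists_mu_eq_sinFun (i : Fin d) : ∃ j, mu j = sinFun i := by
  refine ⟨⟨2 * i + 2, by omega⟩, ?_⟩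
  rw [mu, dif_neg (by simp [Fin.ext_iff]), if_neg (by simp [Nat.odd_add])]
  congr 1
  ext
  change (2 * (i : ℕ) + 2 - 1) / 2 = i
  omega

theorem kickable_smul_mu (a : ℝ) (j : Fin (2 * d + 1)) : Kickable (a • mu (d := d) j) := by
  simpa [Pi.single_apply, ite_smul] using kickable_potential (Pi.single j a)

theorem kickable_const (a : ℝ) : Kickable (a • (1 : C(Torus d, ℝ))) := by
  rw [← mu_zero]
  exact kickable_smul_mu a 0

theorem trig_zero (c : ℂ) : trig (0 : Fin d → ℤ) c = c.re • (1 : C(Torus d, ℝ)) := by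
  ext x
  simp [trig_apply, expo_zero]

theorem expo_single_eq_cos_add_sin (i : Fin d) (x : Torus d) :
    expo (Pi.single i 1) x = cosFun i x + sinFun i x * Complex.I := by
  obtain ⟨θ, hθ⟩ := QuotientAddGroup.mk_surjective (x i)
  have hcos : cosFun i x = Real.cos θ := congrArg Real.Angle.cos hθ.symm
  have hsin : sinFun i x = Real.sin θ := congrArg Real.Angle.sin hθ.symm
  have harg : 2 * Real.pi / (2 * Real.pi) * θ = θ := by
    rw [div_self Real.two_pi_pos.ne', one_mul]
  rw [expo_single, fourier_one, hcos, hsin, ← hθ]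
  change (AddCircle.toCircle (θ : AddCircle (2 * Real.pi)) : ℂ) = _
  rw [AddCircle.toCircle_apply_mk, harg, Circle.coe_exp, Complex.exp_mul_I, Complex.ofReal_cos,
    Complex.ofReal_sin]

theorem trig_single (i : Fin d) (c : ℂ) :
    trig (Pi.single i 1) c = c.re • cosFun i + (-c.im) • sinFun i := by
  ext x
  simp [trig_apply, expo_single_eq_cos_add_sin, sub_eq_add_neg]

theorem re_sq_add_im_sq_expo (k : Fin d → ℤ) (x : Torus d) :
    (expo k x).re ^ 2 + (expo k x).im ^ 2 = 1 := by
  have h := congrArg Complex.re (expo_mul_conj k x)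
  rw [Complex.mul_conj, Complex.ofReal_re, Complex.normSq_apply, Complex.one_re] at h
  rw [sq, sq, h]

/-- With `z = c e^{ik·x}` and `w = e^{im·x}`, this is
`-2 Re (z w̄) = |z|² + |w|² - (Re z + Re w)² - (Im z + Im w)²`. -/
theorem trig_sub_eq (k m : Fin d → ℤ) (c : ℂ) :
    trig (k - m) (-2 * c) = -((trig k c + trig m 1) * (trig k c + trig m 1))
      + -((trig k (-Complex.I * c) + trig m (-Complex.I))
        * (trig k (-Complex.I * c) + trig m (-Complex.I)))
      + (c.re ^ 2 + c.im ^ 2 + 1) • (1 : C(Torus d, ℝ)) := by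
  ext x
  simp only [trig_apply, ContinuousMap.add_apply, ContinuousMap.neg_apply, ContinuousMap.mul_apply,
    ContinuousMap.smul_apply, ContinuousMap.one_apply, smul_eq_mul, sub_eq_add_neg, expo_add,
    expo_neg, Complex.mul_re, Complex.mul_im, Complex.neg_re, Complex.neg_im, Complex.I_re,
    Complex.I_im, Complex.one_re, Complex.one_im, Complex.conj_re, Complex.conj_im,
    Complex.re_ofNat, Complex.im_ofNat]
  linear_combination (c.re ^ 2 + c.im ^ 2) * re_sq_add_im_sq_expo k x + re_sq_add_im_sq_expo m x

theorem kickable_trig_sub {k m : Fin d → ℤ} (hk : ∀ c, Kickable (trig k c))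
    (hm : ∀ c, Kickable (trig m c)) (c : ℂ) : Kickable (trig (k - m) c) := by
  have hsq : ∀ b b' : ℂ, Kickable (-((trig k b + trig m b') * (trig k b + trig m b'))) := by
    intro b b'
    refine Kickable.neg_sq (fun a => ?_) fun w => ?_
    · rw [smul_add, smul_trig, smul_trig]
      exact (hk _).add (hm _)
    · obtain ⟨g, hg⟩ := exists_toL2_eq_mulCLM_trig k b w
      obtain ⟨g', hg'⟩ := exists_toL2_eq_mulCLM_trig m b' w
      exact ⟨g + g', by rw [map_add, map_add, add_apply, hg, hg']⟩
  have hc : -2 * (-c / 2) = c := by ring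
  rw [← hc, trig_sub_eq]
  exact ((hsq _ _).add (hsq _ _)).add (kickable_const _)

variable (d) in
/-- The group of frequencies all of whose monomials are realizable kicks. -/
def kickableFrequencies : AddSubgroup (Fin d → ℤ) :=
  AddSubgroup.ofSub {k | ∀ c, Kickable (trig k c)}
    ⟨0, fun c => by
      rw [trig_zero]
      exact kickable_const _⟩
    fun _ hk _ hm c => by
      rw [← sub_eq_add_neg]
      exact kickable_trig_sub hk hm c

theorem kickable_trig (k : Fin d → ℤ) (c : ℂ) : Kickable (trig k c) := by
  have hsingle : ∀ i, Pi.single i (1 : ℤ) ∈ kickableFrequencies d := by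
    intro i b
    rw [trig_single]
    obtain ⟨j, hj⟩ := exists_mu_eq_cosFun i
    obtain ⟨j', hj'⟩ := exists_mu_eq_sinFun i
    rw [← hj, ← hj']
    exact (kickable_smul_mu _ j).add (kickable_smul_mu _ j')
  have hk : k ∈ kickableFrequencies d := by
    rw [← Finset.univ_sum_single k]
    refine sum_mem fun i _ => ?_
    have hmul : Pi.single i (k i) = k i • (Pi.single i (1 : ℤ) : Fin d → ℤ) := by
      rw [← Pi.single_smul, smul_eq_mul, mul_one]
    rw [hmul]
    exact zsmul_mem (hsingle i) _
  exact hk c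

end Trig

/-! ### Zeros of trigonometric polynomials -/

section Zeros

theorem measure_eq_zero_of_forall_translate {G Y : Type*} [AddGroup G] [MeasurableSpace G]
    [MeasurableAdd₂ G] {μ : Measure G} [SFinite μ] [μ.IsAddRightInvariant] [MeasurableSpace Y]
    {ν : Measure Y} [SFinite ν] [NeZero ν] {φ : Y → G} (hφ : Measurable φ) {s : Set G}
    (hs : MeasurableSet s) (h : ∀ x, ν {y | x + φ y ∈ s} = 0) : μ s = 0 := by
  have hE : MeasurableSet {p : G × Y | p.1 + φ p.2 ∈ s} :=
    (measurable_fst.add (hφ.comp measurable_snd)) hs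
  have hprod : μ.prod ν {p : G × Y | p.1 + φ p.2 ∈ s} = 0 :=
    (Measure.measure_prod_null hE).2 (Eventually.of_forall h)
  have htranslate : ∀ y, μ ((fun x => (x, y)) ⁻¹' {p : G × Y | p.1 + φ p.2 ∈ s}) = μ s := fun y =>
    measure_preimage_add_right μ (φ y) s
  rw [Measure.prod_apply_symm hE] at hprod
  simp only [htranslate, lintegral_const, mul_eq_zero] at hprod
  exact hprod.resolve_right (Measure.measure_univ_ne_zero.2 (NeZero.ne ν))

theorem exists_injOn_sum_mul {d : ℕ} (S : Finset (Fin d → ℤ)) :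
    ∃ v : Fin d → ℤ, Set.InjOn (fun k : Fin d → ℤ => ∑ i, k i * v i) S := by
  classical
  set R : Polynomial ℤ := ∏ p ∈ S.offDiag, Polynomial.ofFn d (p.1 - p.2)
  have hR : R ≠ 0 := Finset.prod_ne_zero_iff.2 fun p hp h =>
    (Finset.mem_offDiag.1 hp).2.2
      (sub_eq_zero.1 (Polynomial.injective_ofFn d (h.trans (map_zero _).symm)))
  obtain ⟨N, hN⟩ : ∃ N : ℤ, R.eval N ≠ 0 := by
    by_contra! h
    exact hR (Polynomial.funext fun N => by simpa using h N)
  refine ⟨fun i => N ^ (i : ℕ), fun k hk m hm h => ?_⟩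
  by_contra hne
  refine hN ?_
  rw [Polynomial.eval_prod]
  refine Finset.prod_eq_zero (i := (k, m)) (Finset.mem_offDiag.2 ⟨hk, hm, hne⟩) ?_
  simpa [Polynomial.ofFn_eq_sum_monomial, Polynomial.eval_finsetSum, sub_mul, sub_eq_zero] using h

theorem fourier_natCast {T : ℝ} (n : ℕ) (θ : AddCircle T) :
    (fourier n θ : ℂ) = fourier 1 θ ^ n := by
  rw [fourier_apply, fourier_one, natCast_zsmul, AddCircle.toCircle_nsmul, Circle.coe_pow]

theorem finite_setOf_eval_fourier_one_eq_zero {T : ℝ} (hT : T ≠ 0) {P : Polynomial ℂ}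
    (hP : P ≠ 0) : {θ : AddCircle T | P.eval (fourier 1 θ : ℂ) = 0}.Finite := by
  have hinj : Function.Injective fun θ : AddCircle T => (fourier 1 θ : ℂ) := fun θ θ' h =>
    AddCircle.injective_toCircle hT (Circle.ext (by simpa only [fourier_one] using h))
  exact (Polynomial.finite_setOfPred_isRoot hP).preimage hinj.injOn

theorem finite_setOf_sum_mul_fourier_eq_zero {T : ℝ} (hT : T ≠ 0) {ι : Type*} {S : Finset ι}
    {a : ι → ℂ} {n : ι → ℤ} (hn : Set.InjOn n S) {i₀ : ι} (hi₀ : i₀ ∈ S) (ha : a i₀ ≠ 0) :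
    {θ : AddCircle T | ∑ i ∈ S, a i * fourier (n i) θ = 0}.Finite := by
  set N : ℤ := ∑ i ∈ S, |n i|
  have hpos : ∀ i ∈ S, 0 ≤ n i + N := fun i hi => by
    linarith [Finset.single_le_sum (f := fun i => |n i|) (fun i _ => abs_nonneg _) hi,
      neg_abs_le (n i)]
  set P : Polynomial ℂ := ∑ i ∈ S, Polynomial.C (a i) * Polynomial.X ^ (n i + N).toNat with hP
  have hcoeff : P.coeff (n i₀ + N).toNat = a i₀ := by
    rw [hP, Polynomial.finsetSum_coeff, Finset.sum_eq_single_of_mem i₀ hi₀]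
    · simp
    · intro i hi hne
      rw [Polynomial.coeff_C_mul_X_pow, if_neg]
      refine fun h => hne (hn hi hi₀ ?_)
      have := hpos i hi
      have := hpos i₀ hi₀
      omega
  have hP0 : P ≠ 0 := fun h => ha (by rw [← hcoeff, h, Polynomial.coeff_zero])
  refine (finite_setOf_eval_fourier_one_eq_zero hT hP0).subset fun θ hθ => ?_
  have heval : P.eval (fourier 1 θ : ℂ) = (∑ i ∈ S, a i * fourier (n i) θ) * fourier N θ := by
    simp only [hP, Polynomial.eval_finsetSum, Polynomial.eval_mul, Polynomial.eval_C,
      Polynomial.eval_pow, Polynomial.eval_X, ← fourier_natCast, Finset.sum_mul]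
    refine Finset.sum_congr rfl fun i hi => ?_
    rw [Int.toNat_of_nonneg (hpos i hi), fourier_add, mul_assoc]
  exact heval.trans (by rw [show ∑ i ∈ S, a i * fourier (n i) θ = 0 from hθ, zero_mul])

theorem fourier_sum {T : ℝ} {ι : Type*} (s : Finset ι) (n : ι → ℤ) (θ : AddCircle T) :
    (fourier (∑ i ∈ s, n i) θ : ℂ) = ∏ i ∈ s, fourier (n i) θ := by
  classical
  induction s using Finset.induction_on with
  | empty => simp
  | insert i s hi ih => rw [Finset.sum_insert hi, Finset.prod_insert hi, fourier_add, ih]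

variable {d : ℕ}

theorem expo_add_zsmul (k v : Fin d → ℤ) (x : Torus d) (θ : AddCircle (2 * Real.pi)) :
    expo k (x + fun i => v i • θ) = expo k x * fourier (∑ i, k i * v i) θ := by
  rw [fourier_sum]
  simp only [expo, ContinuousMap.coe_mk, ← Finset.prod_mul_distrib]
  refine Finset.prod_congr rfl fun i _ => ?_
  simp only [fourier_apply, Pi.add_apply, smul_add, smul_smul, AddCircle.toCircle_add,
    Circle.coe_mul]

/-- Along a direction in which the frequencies stay distinct, a nonzero trigonometric polynomial
has finitely many zeros; integrate over all lines with this direction. -/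
theorem ae_sum_mul_expo_ne_zero {S : Finset (Fin d → ℤ)} {c : (Fin d → ℤ) → ℂ} {k₀ : Fin d → ℤ}
    (hk₀ : k₀ ∈ S) (hc : c k₀ ≠ 0) : ∀ᵐ x : Torus d, ∑ k ∈ S, c k * expo k x ≠ 0 := by
  obtain ⟨v, hv⟩ := exists_injOn_sum_mul S
  rw [ae_iff]
  simp only [not_not]
  have : NeZero (volume : Measure (AddCircle (2 * Real.pi))) := ⟨fun h => by
    simpa [h, Real.pi_pos.not_ge] using AddCircle.measure_univ (2 * Real.pi)⟩
  have : NullSingletonClass (volume : Measure (AddCircle (2 * Real.pi))) := ⟨fun θ => by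
    rw [← Metric.closedBall_zero, AddCircle.volume_closedBall]
    simp [Real.pi_pos.le]⟩
  have hline : Measurable fun (θ : AddCircle (2 * Real.pi)) i => v i • θ :=
    Continuous.measurable (by fun_prop)
  refine measure_eq_zero_of_forall_translate (ν := volume) hline
    (isClosed_eq (by fun_prop) continuous_const).measurableSet fun x => ?_
  have hfin := finite_setOf_sum_mul_fourier_eq_zero Real.two_pi_pos.ne'
    (a := fun k => c k * expo k x) hv hk₀ (mul_ne_zero hc (expo_ne_zero k₀ x))
  simpa only [mem_ofPred_eq, expo_add_zsmul, mul_assoc] using hfin.measure_zero volume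

end Zeros

/-! ### Control of the velocity -/

section Velocity

variable {d : ℕ}

theorem FinitelyManyModes.ae_eq_sum {w : L2 d} (hw : FinitelyManyModes w) :
    ∀ᵐ x, (w x : ℂ) = ∑ k ∈ Set.Finite.toFinset hw, coef w k * phi k x := by
  have hsum : toComplex d w
      = ContinuousMap.toLp 2 volume ℂ (∑ k ∈ Set.Finite.toFinset hw, coef w k • phi k) := by
    have h := (phiBasis d).hasSum_repr (toComplex d w)
    simp only [phiBasis_repr_toComplex, phiBasis_apply] at h
    rw [map_sum]
    refine h.unique ((hasSum_sum_of_ne_finset_zero fun k hk => ?_).congr_fun fun k => ?_)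
    · rw [not_not.1 (mt (Set.Finite.mem_toFinset hw).2 hk), zero_smul, map_zero]
    · rw [map_smul, phiLp]
  filter_upwards [coeFn_toComplex w,
    ContinuousMap.coeFn_toLp (p := 2) (𝕜 := ℂ) volume
      (∑ k ∈ Set.Finite.toFinset hw, coef w k • phi k)] with x hw hx
  rw [← hw, hsum, hx]
  simp

theorem FinitelyManyModes.exists_ae_eq {w : L2 d} (hw : FinitelyManyModes w) :
    ∃ m : C(Torus d, ℝ), w =ᵐ[volume] m := by
  refine ⟨∑ k ∈ Set.Finite.toFinset hw, modeFun k (coef w k), ?_⟩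
  filter_upwards [hw.ae_eq_sum] with x hx
  rw [← Complex.ofReal_re (w x), hx, Complex.re_sum, ContinuousMap.sum_apply]
  rfl

theorem FinitelyManyModes.ae_ne_zero {w : L2 d} (hw : FinitelyManyModes w) (hne : w ≠ 0) :
    ∀ᵐ x, w x ≠ 0 := by
  obtain ⟨k₀, hk₀⟩ : ∃ k, coef w k ≠ 0 := by
    by_contra! h
    exact hne (L2_ext fun k => by rw [h, coef_zero])
  have hk₀S : k₀ ∈ Set.Finite.toFinset hw := (Set.Finite.mem_toFinset hw).2 hk₀
  filter_upwards [hw.ae_eq_sum, ae_sum_mul_expo_ne_zero (c := fun k => coef w k * normConst d)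
    hk₀S (mul_ne_zero hk₀ (Complex.ofReal_ne_zero.2 (normConst_ne_zero d)))] with x hx hne hzero
  rw [hzero, Complex.ofReal_zero] at hx
  refine hne ?_
  simpa only [phi_apply, mul_assoc] using hx.symm

variable (d) in
/-- The real trigonometric polynomials. -/
def trigSpan : Submodule ℝ C(Torus d, ℝ) :=
  Submodule.span ℝ (range fun p : (Fin d → ℤ) × ℂ => trig p.1 p.2)

theorem kickable_of_mem_trigSpan {f : C(Torus d, ℝ)} (hf : f ∈ trigSpan d) : Kickable f := by
  induction hf using Submodule.closure_induction with
  | zero => exact kickable_zero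
  | add f g _ _ hf hg => exact hf.add hg
  | smul_mem a f hf =>
    obtain ⟨⟨k, c⟩, rfl⟩ := hf
    rw [smul_trig]
    exact kickable_trig _ _

theorem inner_mode_mulCLM {w : L2 d} {m : C(Torus d, ℝ)} (hm : w =ᵐ[volume] m) (g : L2 d)
    (k : Fin d → ℤ) (c : ℂ) :
    inner ℝ (mode k c) (mulCLM m g) = inner ℝ (mulCLM (trig k (c * normConst d)) w) g := by
  rw [L2.inner_def, L2.inner_def]
  refine integral_congr_ae ?_
  filter_upwards [coeFn_mode k c, coeFn_mulCLM m g, coeFn_mulCLM (trig k (c * normConst d)) w, hm]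
    with x hmode hmg htrig hwm
  rw [hmode, hmg, htrig, hwm, trig_apply, phi_apply, mul_assoc]
  simp only [RCLike.inner_apply, conj_trivial]
  ring

/-- A function orthogonal to all the `f w` has product zero with `w`, which vanishes almost
nowhere. -/
theorem dense_map_trigSpan {w : L2 d} (hw : FinitelyManyModes w) (hne : w ≠ 0) :
    Dense ((trigSpan d).map (mulCLM.flip w).toLinearMap : Set (L2 d)) := by
  rw [Submodule.dense_iff_topologicalClosure_eq_top, Submodule.topologicalClosure_eq_top_iff,
    Submodule.eq_bot_iff]
  intro g hg
  obtain ⟨m, hm⟩ := hw.exists_ae_eq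
  have hinner : ∀ k c, inner ℝ (mode k c) (mulCLM m g) = 0 := fun k c => by
    have htrig : trig k (c * normConst d) ∈ trigSpan d :=
      Submodule.subset_span (mem_range_self (k, c * (normConst d : ℂ)))
    rw [inner_mode_mulCLM hm]
    exact Submodule.inner_right_of_mem_orthogonal
      (Submodule.mem_map_of_mem (f := (mulCLM.flip w).toLinearMap) htrig) hg
  have hzero : mulCLM m g = 0 := L2_ext fun k => by
    rw [coef_zero, coef_eq_inner, hinner, hinner, Complex.ofReal_zero, zero_mul, add_zero]
  have hmg := coeFn_mulCLM m g
  rw [hzero] at hmg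
  rw [Lp.eq_zero_iff_ae_eq_zero]
  filter_upwards [hmg, Lp.coeFn_zero ℝ 2 (volume : Measure (Torus d)), hm, hw.ae_ne_zero hne]
    with x hx h0 hwm hwx
  rw [h0, ← hwm] at hx
  exact (mul_eq_zero.1 hx.symm).resolve_left hwx

theorem toL2_ne_zero {w : H1 d} (hw : w ≠ 0) : w.toL2 ≠ 0 := fun h =>
  hw (H1_ext fun k => by rw [h, map_zero])

theorem smallTimeReachable_velocity {w : H1 d} (hw : FinitelyManyModes w.toL2) (hne : w ≠ 0)
    (v v' : L2 d) : SmallTimeReachable (waveGroup d) (controlCLM d) (w, v) (w, v') := by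
  have hclosed : IsClosed {u : L2 d |
      SmallTimeReachable (waveGroup d) (controlCLM d) (w, v) (w, v + u)} :=
    (SmallTimeReachable.isClosed_setOf (w, v)).preimage (f := fun u => (w, v + u)) (by fun_prop)
  have hmap : ((trigSpan d).map (mulCLM.flip w.toL2).toLinearMap : Set (L2 d)) ⊆
      {u | SmallTimeReachable (waveGroup d) (controlCLM d) (w, v) (w, v + u)} := by
    rintro _ ⟨f, hf, rfl⟩
    simpa [kick_apply] using! kickable_of_mem_trigSpan hf (w, v)
  have huniv := hclosed.closure_subset_iff.2 hmap
  rw [(dense_map_trigSpan hw (toL2_ne_zero hne)).closure_eq] at huniv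
  simpa using huniv (mem_univ (v' - v))

end Velocity

/-! ### Control of the state -/

section StateControl

variable {d : ℕ}

theorem FinitelyManyModes.of_coef {f g : L2 d} (hg : FinitelyManyModes g)
    (h : ∀ k, coef g k = 0 → coef f k = 0) : FinitelyManyModes f :=
  hg.subset fun k hk hk' => hk (h k hk')

theorem finitelyManyModes_mode (k : Fin d → ℤ) (c : ℂ) : FinitelyManyModes (mode k c) := by
  refine (Set.toFinite {k, -k}).subset fun j hj => ?_
  by_contra h
  rw [mem_insert_iff, mem_singleton_iff, not_or] at h
  exact hj (coef_mode_eq_zero k j c h.1 h.2)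

variable (d) in
/-- The functions of `L²(𝕋ᵈ, ℝ)` with finitely many nonzero Fourier coefficients. -/
def finiteModes : Submodule ℝ (L2 d) where
  carrier := {f | FinitelyManyModes f}
  zero_mem' := by simp [FinitelyManyModes, coef_zero]
  add_mem' {f g} hf hg := (hf.union hg).subset fun k hk => by
    by_contra h
    rw [mem_union, not_or, mem_ofPred_eq, mem_ofPred_eq, not_not, not_not] at h
    exact hk (by rw [coef_add, h.1, h.2, add_zero])
  smul_mem' a _ hf := hf.of_coef fun k hk => by rw [coef_smul, hk, mul_zero]

theorem dense_comap_finiteModes : Dense ((finiteModes d).comap H1.toL2 : Set (H1 d)) := fun u =>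
  mem_closure_of_tendsto (H1.hasSum_mode_coef u) (Eventually.of_forall fun _ =>
    sum_mem fun k _ => finitelyManyModes_mode k _)

theorem tendsto_cosOp_add_inv_smul_sinOp (w₀ w : H1 d) :
    Tendsto (fun t : ℝ => cosOp (H1 d) t w₀ + t⁻¹ • sinOp d t (w - w₀).toL2) (𝓝[>] 0) (𝓝 w) := by
  have hcos : Tendsto (fun t : ℝ => cosOp (H1 d) t w₀) (𝓝[>] 0) (𝓝 w₀) := by
    have hzero : cosOp (H1 d) 0 w₀ = w₀ := H1_ext fun k => by simp [coef_cosOp_H1]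
    simpa only [hzero] using
      ((continuous_cosOp_apply w₀).tendsto 0).mono_left nhdsWithin_le_nhds
  have hsin := (tendsto_inv_smul_sinOp_toL2 (w - w₀)).mono_left (nhdsGT_le_nhdsNE 0)
  simpa only [add_sub_cancel] using hcos.add hsin

/-- A large velocity `t⁻¹ (w - w₀)` moves the profile from `w₀` to `w` in the small time `t`. -/
theorem smallTimeReachable_of_finitelyManyModes {w₀ w : H1 d} (hw₀ : FinitelyManyModes w₀.toL2)
    (hne₀ : w₀ ≠ 0) (hw : FinitelyManyModes w.toL2) (hne : w ≠ 0) (v₀ v : L2 d) :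
    SmallTimeReachable (waveGroup d) (controlCLM d) (w₀, v₀) (w, v) := by
  have hlim := tendsto_cosOp_add_inv_smul_sinOp w₀ w
  refine .of_tendsto isOperatorGroup_waveGroup (r := fun t => t)
    (a := fun t => (w₀, t⁻¹ • (w - w₀).toL2))
    (tendsto_id'.2 (nhdsWithin_mono 0 Ioi_subset_Ici_self))
    (Eventually.of_forall fun t => smallTimeReachable_velocity hw₀ hne₀ v₀ _) ?_
    (hlim.prodMk_nhds (tendsto_const_nhds (x := v)))
  filter_upwards [hlim.eventually (isOpen_ne.mem_nhds hne)] with t ht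
  rw [waveGroup_apply, map_smul]
  refine smallTimeReachable_velocity ?_ ht _ v
  rw [map_add, map_smul]
  refine (finiteModes d).add_mem (hw₀.of_coef fun k hk => ?_)
    ((finiteModes d).smul_mem _ (FinitelyManyModes.of_coef (g := (w - w₀).toL2) ?_ fun k hk => ?_))
  · rw [coef_cosOp_H1, hk, mul_zero]
  · rw [map_sub]
    exact (finiteModes d).sub_mem hw hw₀
  · rw [coef_sinOp, hk, mul_zero]

theorem smallTimeReachable_of_profile_ne_zero {w₀ : H1 d} (hw₀ : FinitelyManyModes w₀.toL2)
    (hne : w₀ ≠ 0) (v₀ : L2 d) (W₁ : State d) :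
    SmallTimeReachable (waveGroup d) (controlCLM d) (w₀, v₀) W₁ := by
  have : Nontrivial (H1 d) := nontrivial_of_ne w₀ 0 hne
  have hdense : Dense ({w : H1 d | FinitelyManyModes w.toL2} ∩ {0}ᶜ) :=
    dense_comap_finiteModes.inter_of_isOpen_right (dense_compl_singleton 0) isOpen_compl_singleton
  have hclosed : IsClosed {w : H1 d |
      SmallTimeReachable (waveGroup d) (controlCLM d) (w₀, v₀) (w, W₁.2)} :=
    (SmallTimeReachable.isClosed_setOf (w₀, v₀)).preimage (f := fun w => (w, W₁.2)) (by fun_prop)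
  exact closure_minimal
    (fun w hw => smallTimeReachable_of_finitelyManyModes hw₀ hne hw.1 hw.2 v₀ W₁.2) hclosed
    (hdense W₁.1)

theorem eventually_sinOp_ne_zero {v : L2 d} (hv : v ≠ 0) : ∀ᶠ t in 𝓝[≠] 0, sinOp d t v ≠ 0 := by
  filter_upwards [(tendsto_inv_smul_toL2_sinOp v).eventually (isOpen_ne.mem_nhds hv)] with t ht h
  exact ht (by rw [h, map_zero, smul_zero])

theorem smallTimeReachable_of_velocity_ne_zero {v₀ : L2 d} (hv₀ : FinitelyManyModes v₀)
    (hne : v₀ ≠ 0) (W₁ : State d) :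
    SmallTimeReachable (waveGroup d) (controlCLM d) (0, v₀) W₁ := by
  refine .of_tendsto isOperatorGroup_waveGroup (l := 𝓝[>] 0) (r := fun t => t)
    (a := fun _ => (0, v₀)) (tendsto_id'.2 (nhdsWithin_mono 0 Ioi_subset_Ici_self))
    (Eventually.of_forall fun _ => .refl isOperatorGroup_waveGroup _) ?_ tendsto_const_nhds
  filter_upwards [(eventually_sinOp_ne_zero hne).filter_mono (nhdsGT_le_nhdsNE 0)] with t ht
  rw [waveGroup_apply, map_zero, zero_add]
  exact smallTimeReachable_of_profile_ne_zero
    (hv₀.of_coef fun k hk => by rw [coef_sinOp, hk, mul_zero]) ht _ W₁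

theorem energyNorm_le (W : State d) : energyNorm W ≤ 2 * ‖W‖ := by
  refine Real.sqrt_le_iff.2 ⟨by positivity, ?_⟩
  have hfst := pow_le_pow_left₀ (norm_nonneg _) (norm_fst_le W) 2
  have hsnd := pow_le_pow_left₀ (norm_nonneg _) (norm_snd_le W) 2
  nlinarith [sq_nonneg ‖W‖]

end StateControl

end BilinearWave

end

open BilinearWave

theorem mainTheorem2 (d : ℕ) (w₀ : H1 d) (v₀ : L2 d)
    (h₀ : (w₀ ≠ 0 ∧ FinitelyManyModes w₀.toL2) ∨ (w₀ = 0 ∧ v₀ ≠ 0 ∧ FinitelyManyModes v₀))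
    (w₁ : H1 d) (v₁ : L2 d) (ε T : ℝ) (hε : 0 < ε) (hT : 0 < T) :
    ∃ τ ∈ Set.Ico 0 T, ∃ p : ℝ → Fin (2 * d + 1) → ℝ, IsPiecewiseConstant τ p ∧
      (∃ W : ℝ → State d, IsSolution τ p (w₀, v₀) W) ∧
      ∀ W : ℝ → State d, IsSolution τ p (w₀, v₀) W → energyNorm (W τ - (w₁, v₁)) < ε := by
  have hreach : SmallTimeReachable (waveGroup d) (controlCLM d) (w₀, v₀) (w₁, v₁) := by
    rcases h₀ with ⟨hne, hfin⟩ | ⟨rfl, hne, hfin⟩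
    · exact smallTimeReachable_of_profile_ne_zero hfin hne v₀ _
    · exact smallTimeReachable_of_velocity_ne_zero hfin hne _
  obtain ⟨τ, hτ, p, hp, hex, hlt⟩ := exists_control_of_mem_closure_reachableSet
    isOperatorGroup_waveGroup (half_pos hε) (hreach T hT)
  simp only [← isSolution_iff] at hex hlt
  exact ⟨τ, hτ, p, hp, hex, fun W hW => (energyNorm_le _).trans_lt (by linarith [hlt W hW])⟩
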